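/- **Setting.** Let $X$ be a Cantor space (a nonempty, compact, totally disconnected, perfect metric space). A *pseudogroup action* $\Phi$ on $X$ is given by a finite partition $X=T_1\sqcup\dots\sqcup T_\nu$ into clopen sets, a reflexive symmetric relation of *admissibility* on $\{1,\dots,\nu\}$, and for each admissible pair $(i,j)$ a homeomorphism $h_{j,i}\colon D_{i,j}\to D_{j,i}$ between nonempty clopen sets $D_{i,j}\subset T_i$, $D_{j,i}\subset T_j$, with $h_{i,j}=h_{j,i}^{-1}$ and $h_{i,i}=\mathrm{id}_{T_i}$. Let $\mathcal G^*$ be the set of all restrictions to open sets of the compositions $h_{i_\alpha,i_{\alpha-1}}\circ\cdots\circ h_{i_1,i_0}$ with nonempty (maximal) domain, along sequences whose consecutive pairs are admissible. For $W\subset X$ let $\mathcal G^*_W$ be the set of $g\in\mathcal G^*$ with domain and range in $W$. The action is *equicontinuous* if for every $\epsilon>0$ there is $\delta>0$ such that $d(g(w),g(w'))<\epsilon$ for all $g\in\mathcal G^*$ and all $w,w'$ in the domain of $g$ with $d(w,w')<\delta$. It is *minimal* if every orbit $\{g(w): g\in\mathcal G^*,\ w\in \mathrm{dom}(g)\}$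 is dense in $X$. Pseudogroup actions $\Phi_1,\Phi_2$ on $X_1,X_2$ are *return equivalent* if there are nonempty open sets $U_i\subset X_i$ and a homeomorphism $\phi\colon U_1\to U_2$ such that $g\mapsto\phi g\phi^{-1}$ maps $\mathcal G^*_{1,U_1}$ to $\mathcal G^*_{2,U_2}$ and $g\mapsto\phi^{-1}g\phi$ maps $\mathcal G^*_{2,U_2}$ to $\mathcal G^*_{1,U_1}$. A clopen set $U\subset X$ is *adapted*, with group $\mathcal H_U$, if $\mathcal H_U$ is a subgroup of $\mathrm{Homeo}(U)$ such that $\mathcal G^*_U$ consists exactly of the restrictions of elements of $\mathcal H_U$ to open subsets of $U$, and if for every $g\in\mathcal G^*$ defined on all of $U$ the set $g(U)$ is contained in $U$ or disjoint from $U$. An *adapted neighborhood basis* at $x\in X$ is a descending sequence $\mathcal U=(U_\ell)_{\ell\ge1}$ of adapted clopen sets containing $x$ with $\bigcap_\ell U_\ell=\{x\}$. Let $\overline{\mathcal H_{U}}$ be the closure of $\mathcal H_U$ in $\mathrm{Homeo}(U)$ for the uniform topology, and $\overline{\mathcal H_{U}}_{,x}$ the isotropy group of $x\in U$ in it. If the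 action is equicontinuous, restriction of maps from $U_\ell$ to $U_{\ell+1}$ defines a sequence of surjective homomorphisms $$\mathcal I(\mathcal U,x)=\{\sigma_\ell\colon \overline{\mathcal H_{U_\ell}}_{,x}\to\overline{\mathcal H_{U_{\ell+1}}}_{,x}\mid \ell\ge 1\}.$$ Two sequences of surjective group homomorphisms $\mathcal A=\{\phi_i\colon A_i\to A_{i+1}\}_{i\ge1}$ and $\mathcal B=\{\psi_i\colon B_i\to B_{i+1}\}_{i\ge1}$ are *tail equivalent* if there are strictly increasing sequences of indices $(p_i)$ and $(q_i)$, a sequence of surjective group homomorphisms $\{\tau_i\colon C_i\to C_{i+1}\}_{i\ge1}$, and isomorphisms $a_i\colon A_{p_i}\to C_{2i-1}$ and $b_i\colon B_{q_i}\to C_{2i}$ such that for all $i\ge1$ $$\tau_{2i}\tau_{2i-1}a_i=a_{i+1}\,\phi_{p_{i+1}-1}\cdots\phi_{p_i},\qquad \tau_{2i+1}\tau_{2i}b_i=b_{i+1}\,\psi_{q_{i+1}-1}\cdots\psi_{q_i}.$$ Write $[\mathcal A]_\infty$ for the tail equivalence class of $\mathcal A$. Let $\mathcal I(\Phi)$,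 the *asymptotic discriminant* of $\Phi$, be the union of the classes $[\mathcal I(\mathcal U,x)]_\infty$ over all $x\in X$ and all adapted neighborhood bases $\mathcal U$ at $x$. **Statement.** Let $\Phi$ be an equicontinuous pseudogroup action on a Cantor space $X$. 1. Every $x\in X$ has an adapted neighborhood basis. 2. If $\mathcal U,\mathcal V$ are adapted neighborhood bases at the same point $x$, then $\mathcal I(\mathcal U,x)$ and $\mathcal I(\mathcal V,x)$ are tail equivalent. 3. If $\mathcal U$, $\mathcal V$ are adapted neighborhood bases at $x$ and at $y=g(x)$ for some $g\in\mathcal G^*$, then $\mathcal I(\mathcal U,x)$ and $\mathcal I(\mathcal V,y)$ are tail equivalent. 4. If $\Phi$ is minimal and $\mathcal U$, $\mathcal V$ are adapted neighborhood bases at arbitrary points $x,y\in X$, then $\mathcal I(\mathcal U,x)$ and $\mathcal I(\mathcal V,y)$ are tail equivalent. 5. If $\Phi$ is minimal, then $\mathcal I(\Phi)=[\mathcal I(\mathcal U,x)]_\infty$ for every $x\in X$ and every adapted neighborhood basis $\mathcal U$ at $x$; so the asymptotic discriminant is one tail equivalence class, independent of the base point and of the adapted neighborhood basis. 6. If $\Phi_1,\Phi_2$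 are equicontinuous minimal pseudogroup actions on Cantor spaces $X_1,X_2$ that are return equivalent, then $\mathcal I(\Phi_1)=\mathcal I(\Phi_2)$. -/

import Mathlib

open Set Filter Topology

universe u v

/-! ### Finitely generated pseudogroup actions -/

/-- A finitely generated pseudogroup action on `X`: a finite partition of `X` into clopen sets `T i`,
a symmetric reflexive admissibility relation on the indices, and for each admissible pair `(i, j)` a
homeomorphism `h i j : D i j → D j i` between nonempty clopen sets `D i j ⊆ T i` and `D j i ⊆ T j`
(here `D i j` is `(h i j).source`), such that `h j i` is the inverse of `h i j` and `h i i` is the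
identity of `T i`. -/
structure PseudogroupAction (X : Type u) [TopologicalSpace X] where
  ν : ℕ
  T : Fin ν → Set X
  isClopen_T : ∀ i, IsClopen (T i)
  disjoint_T : ∀ i j, i ≠ j → Disjoint (T i) (T j)
  iUnion_T : ⋃ i, T i = univ
  adm : Fin ν → Fin ν → Prop
  adm_refl : ∀ i, adm i i
  adm_symm : ∀ i j, adm i j → adm j i
  h : Fin ν → Fin ν → OpenPartialHomeomorph X X
  source_subset : ∀ i j, adm i j → (h i j).source ⊆ T i
  source_nonempty : ∀ i j, adm i j → (h i j).source.Nonempty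
  isClopen_source : ∀ i j, adm i j → IsClopen (h i j).source
  symm_h : ∀ i j, adm i j → (h i j).symm ≈ h j i
  source_refl : ∀ i, (h i i).source = T i
  h_refl : ∀ i, ∀ x ∈ T i, h i i x = x

namespace PseudogroupAction

section Topological

variable {X : Type u} [TopologicalSpace X] (Φ : PseudogroupAction X)

/-- For a sequence `(i₀, i₁, …, i_α)`, written `i₀` followed by the list `[i₁, …, i_α]`, the
composition `h_{i_{α-1} i_α} ∘ ⋯ ∘ h_{i₀ i₁}` with its maximal domain (for the sequence `(i₀)`
it is the identity of `T i₀`). -/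
noncomputable def word : Fin Φ.ν → List (Fin Φ.ν) → OpenPartialHomeomorph X X
  | i, [] => Φ.h i i
  | i, j :: l => (Φ.h i j).trans (word j l)

/-- The pseudo⋆group `𝒢*`: all restrictions to open sets of the compositions along admissible
sequences with nonempty domain. A local homeomorphism `g` is a map defined on `g.source`; its values
elsewhere play no role. -/
def Star (g : OpenPartialHomeomorph X X) : Prop :=
  ∃ (i : Fin Φ.ν) (l : List (Fin Φ.ν)), List.IsChain Φ.adm (i :: l) ∧
    (Φ.word i l).source.Nonempty ∧ g.source ⊆ (Φ.word i l).source ∧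
    ∀ x ∈ g.source, g x = Φ.word i l x

/-- The restriction `𝒢*_W` of `𝒢*` to `W`: the elements whose domain and range lie in `W`. -/
def StarOn (W : Set X) (g : OpenPartialHomeomorph X X) : Prop :=
  Φ.Star g ∧ g.source ⊆ W ∧ g.target ⊆ W

/-- The action is minimal: every orbit is dense. -/
def Minimal : Prop :=
  ∀ w : X, Dense {y : X | ∃ g, Φ.Star g ∧ w ∈ g.source ∧ g w = y}

/-- A clopen set `U = carrier` adapted to the action, with group `H = ℋ_U ⊆ Homeo(U)`: the restricted
pseudo⋆group `𝒢*_U` is induced by the action of `H` on `U`, that is, it consists exactly of the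
restrictions of elements of `H` to open subsets of `U`; and every translate of `U` by an element of
`𝒢*` is contained in `U` or disjoint from `U`. The group `H` is determined by `U`. -/
structure AdaptedSet where
  carrier : Set X
  isClopen : IsClopen carrier
  H : Subgroup (carrier ≃ₜ carrier)
  induced : ∀ g : OpenPartialHomeomorph X X, Φ.StarOn carrier g ↔
    g.source ⊆ carrier ∧ ∃ h ∈ H, ∀ u : carrier, (u : X) ∈ g.source → g u = (h u : X)
  translate : ∀ g : OpenPartialHomeomorph X X, Φ.Star g → carrier ⊆ g.source →
    g '' carrier ⊆ carrier ∨ Disjoint (g '' carrier) carrier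

/-- An adapted neighborhood basis at `x`: a descending chain of adapted clopen sets containing `x`
with intersection `{x}`. (Indices start at `0`.) -/
structure AdaptedBasis (x : X) where
  U : ℕ → Φ.AdaptedSet
  mem : ∀ l, x ∈ (U l).carrier
  descending : ∀ l, (U (l + 1)).carrier ⊆ (U l).carrier
  iInter_eq : ⋂ l, (U l).carrier = {x}

end Topological

/-- Return equivalence of two pseudogroup actions: there is a homeomorphism `φ : U₁ → U₂` between
nonempty open sets such that `g ↦ φ ∘ g ∘ φ⁻¹` maps `𝒢*_{U₁}` to `𝒢*_{U₂}`, and `g ↦ φ⁻¹ ∘ g ∘ φ` maps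
`𝒢*_{U₂}` to `𝒢*_{U₁}`. -/
def ReturnEquivalent {X₁ : Type u} {X₂ : Type v} [TopologicalSpace X₁] [TopologicalSpace X₂]
    (Φ₁ : PseudogroupAction X₁) (Φ₂ : PseudogroupAction X₂) : Prop :=
  ∃ φ : OpenPartialHomeomorph X₁ X₂, φ.source.Nonempty ∧
    (∀ g, Φ₁.StarOn φ.source g → Φ₂.StarOn φ.target ((φ.symm.trans g).trans φ)) ∧
    (∀ g, Φ₂.StarOn φ.target g → Φ₁.StarOn φ.source ((φ.trans g).trans φ.symm))

/-- The pseudogroup action is equicontinuous: the elements of `𝒢*` are equicontinuous, uniformly. -/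
def Equicontinuous {X : Type u} [MetricSpace X] (Φ : PseudogroupAction X) : Prop :=
  ∀ ε > 0, ∃ δ > 0, ∀ g, Φ.Star g → ∀ w ∈ g.source, ∀ w' ∈ g.source,
    dist w w' < δ → dist (g w) (g w') < ε

end PseudogroupAction

/-! ### Sequences of surjective group homomorphisms and tail equivalence -/

/-- A sequence of surjective group homomorphisms `G 0 → G 1 → G 2 → ⋯`. -/
structure SurjSeq where
  G : ℕ → Type u
  [group : ∀ i, Group (G i)]
  map : ∀ i, G i →* G (i + 1)
  surj : ∀ i, Function.Surjective (map i)

namespace SurjSeq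

instance (A : SurjSeq.{u}) (i : ℕ) : Group (A.G i) := A.group i

/-- The composition `A.map (n - 1) ∘ ⋯ ∘ A.map m : A.G m → A.G n`. -/
def comp (A : SurjSeq.{u}) {m n : ℕ} (hmn : m ≤ n) : A.G m →* A.G n :=
  Nat.leRec (motive := fun n _ => A.G m →* A.G n) (MonoidHom.id _)
    (fun k _ f => (A.map k).comp f) hmn

/-- Tail equivalence: subsequences of `A` and `B` are intertwined by a sequence `C` of surjective
group homomorphisms whose terms of even index are isomorphic to the groups `A.G (p i)` and whose
terms of odd index are isomorphic to the groups `B.G (q i)` (all indices start at `0`). -/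
def TailEquiv (A B : SurjSeq.{u}) : Prop :=
  ∃ (p q : ℕ → ℕ) (hp : StrictMono p) (hq : StrictMono q) (C : SurjSeq.{u})
    (a : ∀ i, A.G (p i) ≃* C.G (2 * i)) (b : ∀ i, B.G (q i) ≃* C.G (2 * i + 1)),
    (∀ i (s : A.G (p i)),
      C.map (2 * i + 1) (C.map (2 * i) (a i s)) =
        a (i + 1) (A.comp (hp.monotone (Nat.le_succ i)) s)) ∧
    (∀ i (t : B.G (q i)),
      C.map (2 * i + 2) (C.map (2 * i + 1) (b i t)) =
        b (i + 1) (B.comp (hq.monotone (Nat.le_succ i)) t))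

/-- The asymptotic class `[A]_∞` of `A`: its tail equivalence class. -/
def asymptoticClass (A : SurjSeq.{u}) : Set SurjSeq.{u} := {B | TailEquiv A B}

end SurjSeq

/-! ### Closures of groups of homeomorphisms -/

/-- The closure of a group of homeomorphisms of a compact metric space in the uniform topology. -/
def uniformClosure {Y : Type u} [MetricSpace Y] [CompactSpace Y] (H : Subgroup (Y ≃ₜ Y)) :
    Subgroup (Y ≃ₜ Y) where
  carrier := {f | ∀ ε > 0, ∃ h ∈ H, ∀ y, dist (f y) (h y) < ε}
  one_mem' := fun ε hε => ⟨1, H.one_mem, fun y => by simpa using hε⟩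
  mul_mem' := by
    intro f g hf hg ε hε
    obtain ⟨δ, hδ, hfδ⟩ := Metric.uniformContinuous_iff.1
      (CompactSpace.uniformContinuous_of_continuous f.continuous) (ε / 2) (half_pos hε)
    obtain ⟨a, ha, hfa⟩ := hf (ε / 2) (half_pos hε)
    obtain ⟨b, hb, hgb⟩ := hg δ hδ
    refine ⟨a * b, H.mul_mem ha hb, fun y => ?_⟩
    calc dist (f (g y)) (a (b y)) ≤ dist (f (g y)) (f (b y)) + dist (f (b y)) (a (b y)) :=
          dist_triangle _ _ _
      _ < ε / 2 + ε / 2 := add_lt_add (hfδ (hgb y)) (hfa _)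
      _ = ε := add_halves ε
  inv_mem' := by
    intro f hf ε hε
    obtain ⟨δ, hδ, hfδ⟩ := Metric.uniformContinuous_iff.1
      (CompactSpace.uniformContinuous_of_continuous f.symm.continuous) ε hε
    obtain ⟨a, ha, hfa⟩ := hf δ hδ
    refine ⟨a⁻¹, H.inv_mem ha, fun y => ?_⟩
    have h1 := hfδ (hfa (a.symm y))
    rw [f.symm_apply_apply, a.apply_symm_apply, dist_comm] at h1
    exact h1

theorem mem_uniformClosure {Y : Type u} [MetricSpace Y] [CompactSpace Y] {H : Subgroup (Y ≃ₜ Y)}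
    {f : Y ≃ₜ Y} : f ∈ uniformClosure H ↔ ∀ ε > 0, ∃ h ∈ H, ∀ y, dist (f y) (h y) < ε := Iff.rfl

/-- Compactness of the uniform closure of an equicontinuous group, in the form needed below: a
sequence in such a group has a uniform cluster point, in the closure of the group. -/
theorem exists_uniform_limit {Y : Type u} [MetricSpace Y] [CompactSpace Y] (H : Subgroup (Y ≃ₜ Y))
    (hH : ∀ ε > 0, ∃ δ > 0, ∀ h ∈ H, ∀ y z, dist y z < δ → dist (h y) (h z) < ε)
    (a : ℕ → (Y ≃ₜ Y)) (ha : ∀ n, a n ∈ H) :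
    ∃ f ∈ uniformClosure H, ∀ y, ∀ ε > 0, ∃ᶠ n in atTop, dist (f y) (a n y) < ε := by
  let F : Ultrafilter ℕ := Ultrafilter.of atTop
  have hF : (F : Filter ℕ) ≤ atTop := Ultrafilter.of_le atTop
  have key : ∀ b : ℕ → (Y ≃ₜ Y), (∀ n, b n ∈ H) → ∃ g : Y → Y, Continuous g ∧
      TendstoUniformly (fun n y => b n y) g (F : Filter ℕ) := by
    intro b hb
    have hlim : ∀ y, ∃ z, Tendsto (fun n => b n y) (F : Filter ℕ) (𝓝 z) := by
      intro y
      obtain ⟨z, -, hz⟩ := isCompact_univ.ultrafilter_le_nhds (F.map fun n => b n y) (by simp)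
      exact ⟨z, hz⟩
    choose g hg using hlim
    have heq : UniformEquicontinuous (fun n y => b n y) := by
      rw [Metric.uniformEquicontinuous_iff]
      intro ε hε
      obtain ⟨δ, hδ, h⟩ := hH ε hε
      exact ⟨δ, hδ, fun x y hxy n => h _ (hb n) x y hxy⟩
    have hu : TendstoUniformly (fun n y => b n y) g (F : Filter ℕ) := by
      have := (heq.equicontinuous.tendsto_uniformFun_iff_pi (F : Filter ℕ) g).2
        (tendsto_pi_nhds.2 hg)
      rw [UniformFun.tendsto_iff_tendstoUniformly] at this
      exact this
    exact ⟨g, hu.continuous (Frequently.of_forall fun n => (b n).continuous), hu⟩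
  obtain ⟨f, hfc, hf⟩ := key a ha
  obtain ⟨g, hgc, hg⟩ := key (fun n => (a n)⁻¹) fun n => H.inv_mem (ha n)
  rw [Metric.tendstoUniformly_iff] at hf hg
  have hgf : Function.LeftInverse g f := by
    intro y
    refine eq_of_forall_dist_le fun ε hε => ?_
    obtain ⟨δ, hδ, hgδ⟩ := Metric.uniformContinuous_iff.1
      (CompactSpace.uniformContinuous_of_continuous hgc) (ε / 2) (half_pos hε)
    obtain ⟨n, hn1, hn2⟩ := ((hf δ hδ).and (hg (ε / 2) (half_pos hε))).exists
    have h2 := hn2 (a n y)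
    have h3 : ((a n)⁻¹ : Y ≃ₜ Y) (a n y) = y := (a n).symm_apply_apply y
    rw [h3] at h2
    calc dist (g (f y)) y ≤ dist (g (f y)) (g (a n y)) + dist (g (a n y)) y := dist_triangle _ _ _
      _ ≤ ε / 2 + ε / 2 := (add_lt_add (hgδ (hn1 y)) h2).le
      _ = ε := add_halves ε
  have hfg : Function.RightInverse g f := by
    intro y
    refine eq_of_forall_dist_le fun ε hε => ?_
    obtain ⟨δ, hδ, hfδ⟩ := Metric.uniformContinuous_iff.1
      (CompactSpace.uniformContinuous_of_continuous hfc) (ε / 2) (half_pos hε)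
    obtain ⟨n, hn1, hn2⟩ := ((hg δ hδ).and (hf (ε / 2) (half_pos hε))).exists
    have h2 := hn2 (((a n)⁻¹ : Y ≃ₜ Y) y)
    have h3 : a n (((a n)⁻¹ : Y ≃ₜ Y) y) = y := (a n).apply_symm_apply y
    rw [h3] at h2
    calc dist (f (g y)) y ≤ dist (f (g y)) (f (((a n)⁻¹ : Y ≃ₜ Y) y)) +
          dist (f (((a n)⁻¹ : Y ≃ₜ Y) y)) y := dist_triangle _ _ _
      _ ≤ ε / 2 + ε / 2 := (add_lt_add (hfδ (hn1 y)) h2).le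
      _ = ε := add_halves ε
  refine ⟨⟨⟨f, g, hgf, hfg⟩, hfc, hgc⟩, ?_, ?_⟩
  · intro ε hε
    obtain ⟨n, hn⟩ := (hf ε hε).exists
    exact ⟨a n, ha n, hn⟩
  · intro y ε hε
    exact ((hf ε hε).mono fun n hn => hn y).frequently.filter_mono hF

namespace PseudogroupAction

variable {X : Type u} [MetricSpace X] [CompactSpace X] {Φ : PseudogroupAction X}

namespace AdaptedSet

instance (U : Φ.AdaptedSet) : CompactSpace U.carrier :=
  isCompact_iff_compactSpace.1 U.isClopen.isClosed.isCompact

/-- The isotropy group at `x` of the closure of `ℋ_U` in the uniform topology on `Homeo(U)`. -/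
def isotropy (U : Φ.AdaptedSet) (x : X) (hx : x ∈ U.carrier) :
    Subgroup (U.carrier ≃ₜ U.carrier) where
  carrier := {f | f ∈ uniformClosure U.H ∧ f ⟨x, hx⟩ = ⟨x, hx⟩}
  one_mem' := ⟨Subgroup.one_mem _, rfl⟩
  mul_mem' := by
    rintro f g ⟨hf, hfx⟩ ⟨hg, hgx⟩
    refine ⟨Subgroup.mul_mem _ hf hg, ?_⟩
    change f (g _) = _
    rw [hgx, hfx]
  inv_mem' := by
    rintro f ⟨hf, hfx⟩
    refine ⟨Subgroup.inv_mem _ hf, ?_⟩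
    change f.symm _ = _
    rw [Homeomorph.symm_apply_eq, hfx]

/-- A homeomorphism of a clopen set `U`, restricted to a clopen subset `V` and seen as a local
homeomorphism of `X`. -/
theorem exists_local (U V : Φ.AdaptedSet) (hVU : V.carrier ⊆ U.carrier) (x : X)
    (hx : x ∈ V.carrier) (h : U.carrier ≃ₜ U.carrier) :
    ∃ g : OpenPartialHomeomorph X X, g.source = V.carrier ∧
      ∀ u : U.carrier, (u : X) ∈ V.carrier → g u = (h u : X) := by
  have : Nonempty U.carrier := ⟨⟨x, hVU hx⟩⟩
  let e : OpenPartialHomeomorph U.carrier X :=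
    U.isClopen.isOpen.isOpenEmbedding_subtypeVal.toOpenPartialHomeomorph _
  have he : ∀ u, e u = (u : X) := fun u => rfl
  have hes : e.source = univ := rfl
  have het : e.target = U.carrier := by
    rw [← e.image_source_eq_target, hes]
    simp [he]
  have hsymm : ∀ u : U.carrier, e.symm (u : X) = u := fun u => e.left_inv (x := u) (by simp [hes])
  refine ⟨((e.symm.trans h.toOpenPartialHomeomorph).trans e).restr V.carrier, ?_, ?_⟩
  · rw [OpenPartialHomeomorph.restr_source' _ _ V.isClopen.isOpen]
    ext y
    simp only [OpenPartialHomeomorph.trans_source, OpenPartialHomeomorph.symm_source, het, hes]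
    simp
    exact fun hy => hVU hy
  · intro u hu
    simp [hsymm, he]

/-- Every element of `ℋ_U` is an element of `𝒢*`, restricted to any adapted subset. -/
theorem exists_star (U V : Φ.AdaptedSet) (hVU : V.carrier ⊆ U.carrier) (x : X)
    (hx : x ∈ V.carrier) (h : U.carrier ≃ₜ U.carrier) (hh : h ∈ U.H) :
    ∃ g : OpenPartialHomeomorph X X, Φ.StarOn U.carrier g ∧ g.source = V.carrier ∧
      ∀ u : U.carrier, (u : X) ∈ V.carrier → g u = (h u : X) := by
  obtain ⟨g, hg, hgh⟩ := exists_local U V hVU x hx h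
  exact ⟨g, (U.induced g).2 ⟨hg.subset.trans hVU, h, hh, fun u hu => hgh u (hg ▸ hu)⟩, hg, hgh⟩

/-- An element of `ℋ_U` moving a point of `V` to a point of `V` restricts to an element of `ℋ_V`. -/
theorem exists_restrict (U V : Φ.AdaptedSet) (hVU : V.carrier ⊆ U.carrier) (x : X)
    (hx : x ∈ V.carrier) (h : U.carrier ≃ₜ U.carrier) (hh : h ∈ U.H)
    (hhx : (h ⟨x, hVU hx⟩ : X) ∈ V.carrier) :
    ∃ k ∈ V.H, ∀ v : V.carrier, (k v : X) = h ⟨v, hVU v.2⟩ := by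
  obtain ⟨g, hg, hgs, hgh⟩ := exists_star U V hVU x hx h hh
  have himg : g '' V.carrier ⊆ V.carrier := by
    refine (V.translate g hg.1 hgs.superset).resolve_right fun hd => ?_
    exact Set.disjoint_left.1 hd ⟨x, hx, hgh ⟨x, hVU hx⟩ hx⟩ hhx
  have hgV : Φ.StarOn V.carrier g := by
    refine ⟨hg.1, hgs.subset, ?_⟩
    rw [← g.image_source_eq_target, hgs]
    exact himg
  obtain ⟨-, k, hk, hgk⟩ := (V.induced g).1 hgV
  refine ⟨k, hk, fun v => ?_⟩
  exact (hgk v (hgs.superset v.2)).symm.trans (hgh ⟨v, hVU v.2⟩ v.2)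

/-- Every element of `ℋ_V` extends to an element of `ℋ_U`. -/
theorem exists_extend (U V : Φ.AdaptedSet) (hVU : V.carrier ⊆ U.carrier) (x : X)
    (hx : x ∈ V.carrier) (k : V.carrier ≃ₜ V.carrier) (hk : k ∈ V.H) :
    ∃ h ∈ U.H, ∀ v : V.carrier, (k v : X) = h ⟨v, hVU v.2⟩ := by
  obtain ⟨g, hg, hgs, hgk⟩ := exists_star V V subset_rfl x hx k hk
  obtain ⟨-, h, hh, hgh⟩ := (U.induced g).1 ⟨hg.1, hg.2.1.trans hVU, hg.2.2.trans hVU⟩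
  exact ⟨h, hh, fun v => (hgk v v.2).symm.trans
    (hgh ⟨v, hVU v.2⟩ (hgs.superset v.2))⟩

/-- The approximation of an isotropy element of `U` by elements of `ℋ_V`, on `V`. -/
theorem isotropy_approx (U V : Φ.AdaptedSet) (hVU : V.carrier ⊆ U.carrier) (x : X)
    (hx : x ∈ V.carrier) {f : U.carrier ≃ₜ U.carrier} (hf : f ∈ U.isotropy x (hVU hx))
    (ε : ℝ) (hε : 0 < ε) :
    ∃ k ∈ V.H, ∀ v : V.carrier, dist (f ⟨v, hVU v.2⟩ : X) (k v) < ε := by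
  obtain ⟨r, hr, hrV⟩ := Metric.isOpen_iff.1 V.isClopen.isOpen x hx
  obtain ⟨h, hh, hfh⟩ := hf.1 (min ε r) (lt_min hε hr)
  have hhx : (h ⟨x, hVU hx⟩ : X) ∈ V.carrier := by
    apply hrV
    have h1 := hfh ⟨x, hVU hx⟩
    rw [hf.2] at h1
    rw [Metric.mem_ball, dist_comm]
    exact lt_of_lt_of_le h1 (min_le_right _ _)
  obtain ⟨k, hk, hkh⟩ := exists_restrict U V hVU x hx h hh hhx
  refine ⟨k, hk, fun v => ?_⟩
  rw [hkh v]
  exact lt_of_lt_of_le (hfh ⟨v, hVU v.2⟩) (min_le_left _ _)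

/-- An isotropy element of `U` at `x ∈ V` maps `V` into itself. -/
theorem isotropy_mapsTo (U V : Φ.AdaptedSet) (hVU : V.carrier ⊆ U.carrier) (x : X)
    (hx : x ∈ V.carrier) {f : U.carrier ≃ₜ U.carrier} (hf : f ∈ U.isotropy x (hVU hx))
    (v : V.carrier) : (f ⟨v, hVU v.2⟩ : X) ∈ V.carrier := by
  refine V.isClopen.isClosed.closure_subset (Metric.mem_closure_iff.2 fun ε hε => ?_)
  obtain ⟨k, -, hk⟩ := isotropy_approx U V hVU x hx hf ε hε
  exact ⟨k v, (k v).2, hk v⟩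

/-- The restriction to `V` of an isotropy element of `U`, as a homeomorphism of `V`. -/
def restrictHomeo (U V : Φ.AdaptedSet) (hVU : V.carrier ⊆ U.carrier) (x : X)
    (hx : x ∈ V.carrier) (f : U.isotropy x (hVU hx)) : V.carrier ≃ₜ V.carrier where
  toFun v := ⟨f.1 ⟨v, hVU v.2⟩, isotropy_mapsTo U V hVU x hx f.2 v⟩
  invFun v := ⟨f.1.symm ⟨v, hVU v.2⟩, isotropy_mapsTo U V hVU x hx (f⁻¹).2 v⟩
  left_inv v := Subtype.ext (by simp)
  right_inv v := Subtype.ext (by simp)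
  continuous_toFun := Continuous.subtype_mk (continuous_subtype_val.comp
    (f.1.continuous.comp (continuous_subtype_val.subtype_mk _))) _
  continuous_invFun := Continuous.subtype_mk (continuous_subtype_val.comp
    (f.1.symm.continuous.comp (continuous_subtype_val.subtype_mk _))) _

/-- The restriction homomorphism `f ↦ f|V` between the isotropy groups at `x` of the closures of
`ℋ_U` and `ℋ_V`, for adapted sets `x ∈ V ⊆ U`. -/
def restrictIsotropy (U V : Φ.AdaptedSet) (hVU : V.carrier ⊆ U.carrier) (x : X)
    (hx : x ∈ V.carrier) : U.isotropy x (hVU hx) →* V.isotropy x hx where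
  toFun f := ⟨restrictHomeo U V hVU x hx f, fun ε hε => by
    obtain ⟨k, hk, h⟩ := isotropy_approx U V hVU x hx f.2 ε hε
    exact ⟨k, hk, h⟩, Subtype.ext (by
      change (f.1 ⟨x, hVU hx⟩ : X) = x
      rw [f.2.2])⟩
  map_one' := rfl
  map_mul' _ _ := rfl

theorem restrictIsotropy_apply (U V : Φ.AdaptedSet) (hVU : V.carrier ⊆ U.carrier) (x : X)
    (hx : x ∈ V.carrier) (f : U.isotropy x (hVU hx)) (v : V.carrier) :
    ((restrictIsotropy U V hVU x hx f).1 v : X) = f.1 ⟨v, hVU v.2⟩ := rfl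

theorem restrictIsotropy_surjective (hΦ : Φ.Equicontinuous) (U V : Φ.AdaptedSet)
    (hVU : V.carrier ⊆ U.carrier) (x : X) (hx : x ∈ V.carrier) :
    Function.Surjective (restrictIsotropy U V hVU x hx) := by
  intro f
  have hpos : ∀ n : ℕ, (0 : ℝ) < 1 / ((n : ℝ) + 1) := fun n => Nat.one_div_pos_of_nat
  choose k hk hfk using fun n : ℕ => f.2.1 (1 / ((n : ℝ) + 1)) (hpos n)
  choose h hh hkh using fun n => exists_extend U V hVU x hx (k n) (hk n)
  have hH : ∀ ε > 0, ∃ δ > 0, ∀ h ∈ U.H, ∀ y z, dist y z < δ → dist (h y) (h z) < ε := by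
    intro ε hε
    obtain ⟨δ, hδ, H⟩ := hΦ ε hε
    refine ⟨δ, hδ, fun h hh y z hyz => ?_⟩
    obtain ⟨g, hg, hgs, hgh⟩ := exists_star U U subset_rfl x (hVU hx) h hh
    have := H g hg.1 y (hgs.superset y.2) z (hgs.superset z.2) hyz
    rwa [hgh y y.2, hgh z z.2] at this
  obtain ⟨F, hF, hFh⟩ := exists_uniform_limit U.H hH h hh
  have hFf : ∀ v : V.carrier, (F ⟨v, hVU v.2⟩ : X) = f.1 v := by
    intro v
    refine eq_of_forall_dist_le fun ε hε => ?_
    have h1 : ∀ᶠ n : ℕ in atTop, 1 / ((n : ℝ) + 1) < ε / 2 :=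
      (tendsto_order.1 tendsto_one_div_add_atTop_nhds_zero_nat).2 _ (half_pos hε)
    obtain ⟨n, hn1, hn2⟩ := ((hFh ⟨v, hVU v.2⟩ (ε / 2) (half_pos hε)).and_eventually h1).exists
    have h2 : dist (f.1 v : X) (k n v) < 1 / ((n : ℝ) + 1) := hfk n v
    rw [hkh n v] at h2
    have h3 : dist (F ⟨v, hVU v.2⟩ : X) (h n ⟨v, hVU v.2⟩) < ε / 2 := hn1
    have h4 := dist_triangle_right (F ⟨v, hVU v.2⟩ : X) (f.1 v) (h n ⟨v, hVU v.2⟩)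
    linarith
  refine ⟨⟨F, hF, Subtype.ext ?_⟩, Subtype.ext (Homeomorph.ext fun v => Subtype.ext (hFf v))⟩
  rw [hFf ⟨x, hx⟩, f.2.2]

end AdaptedSet

/-- The sequence `ℐ(𝒰, x)` of surjective homomorphisms of an adapted neighborhood basis `𝒰` at `x`:
its groups are the isotropy groups at `x` of the closures of `ℋ_{U_ℓ}` in `Homeo(U_ℓ)`, its maps are
the restrictions from `U_ℓ` to `U_{ℓ+1}`. -/
def AdaptedBasis.isotropySeq {x : X} (𝒰 : Φ.AdaptedBasis x) (hΦ : Φ.Equicontinuous) :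
    SurjSeq.{u} where
  G l := (𝒰.U l).isotropy x (𝒰.mem l)
  map _ := AdaptedSet.restrictIsotropy _ _ (𝒰.descending _) x (𝒰.mem _)
  surj _ := AdaptedSet.restrictIsotropy_surjective hΦ _ _ _ _ _

/-- The asymptotic discriminant `ℐ(Φ)`: the collection of all sequences of surjective homomorphisms
that are tail equivalent to `ℐ(𝒰, x)` for some basepoint `x` and some adapted neighborhood basis `𝒰`
at `x`. For a minimal action this is one tail equivalence class, given by any of these choices. -/
def asymptoticDiscriminant (Φ : PseudogroupAction X) (hΦ : Φ.Equicontinuous) : Set SurjSeq.{u} :=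
  ⋃ (x : X) (𝒰 : Φ.AdaptedBasis x), (𝒰.isotropySeq hΦ).asymptoticClass

end PseudogroupAction

/-! Tail equivalence has a finite description. It amounts to one surjection `s : A.G m →* B.G n`
such that the kernels in `A.G m` of the maps to later groups of `A`, and those of the maps to later
groups of `B` through `s`, are cofinal in each other (`Intertwined`). In one direction, `s` is the
first map of `C`. In the other, the interlacing sequence consists of the quotients of `A.G m` by
kernels taken alternately from the two families. This form makes symmetry and transitivity
accessible, and it is the form verified geometrically.

Adapted sets come from equicontinuity. For clopen `W`, two points are identified when no word tells
them apart by its domain or by the preimage of `W`. Equicontinuity gives a radius that serves all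
words at once, so the classes (cells) are clopen. Words permute the cells they are defined on, so
cells are adapted, and total disconnectedness makes them small.

For the comparison of discriminants, let `φ` be a local homeomorphism with `φ x = y` such that
conjugation by `φ` and by its inverse preserves uniform limits of elements of `𝒢*` (`Transfers`).
Conjugation then carries germs of isotropy elements at `x` to those at `y`. On small enough basis
sets it is a homomorphism `S`. It is surjective because isotropy elements extend to larger adapted
sets, and the kernels are cofinal because triviality near `x` corresponds to triviality near `y`
(`Transfers.tailEquiv`).

All the cases are choices of `φ`: an identity for one point, an element of `𝒢*` for one orbit, the
given homeomorphism for return equivalence. For a minimal action, the orbit of `x` enters an adapted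
set around `y`, and the closure of its group is transitive there by compactness; an element of this
closure is the last `φ`. It need not lie in `𝒢*`, which is why `Transfers` is stated for uniform
limits. -/

namespace SurjSeq

/-! ### Tail equivalence of sequences of surjections -/

theorem comp_refl (A : SurjSeq.{u}) (m : ℕ) (s : A.G m) : A.comp (le_refl m) s = s := by
  simp [comp, Nat.leRec_self]

theorem comp_succ (A : SurjSeq.{u}) {m n : ℕ} (h : m ≤ n) (h' : m ≤ n + 1) (s : A.G m) :
    A.comp h' s = A.map n (A.comp h s) := by
  simp [comp, Nat.leRec_succ _ _ h]

theorem comp_comp (A : SurjSeq.{u}) {l m n : ℕ} (h : l ≤ m) (h' : m ≤ n) (h'' : l ≤ n)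
    (s : A.G l) : A.comp h' (A.comp h s) = A.comp h'' s := by
  induction n, h' using Nat.le_induction with
  | base => rw [comp_refl]
  | succ n hmn ih => rw [comp_succ A hmn, ih (h.trans hmn), comp_succ A (h.trans hmn)]

theorem comp_surjective (A : SurjSeq.{u}) {m n : ℕ} (h : m ≤ n) :
    Function.Surjective (A.comp h) := by
  induction n, h using Nat.le_induction with
  | base => exact fun s => ⟨s, comp_refl A m s⟩
  | succ n hmn ih =>
    intro t
    obtain ⟨r, rfl⟩ := A.surj n t
    obtain ⟨s, rfl⟩ := ih r
    exact ⟨s, comp_succ A hmn _ s⟩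

theorem comp_eq_one_of_le (A : SurjSeq.{u}) {l m n : ℕ} {h : l ≤ m} (h' : m ≤ n) {s : A.G l}
    (hs : A.comp h s = 1) : A.comp (h.trans h') s = 1 := by
  rw [← A.comp_comp h h', hs, map_one]

/-- A single surjection `s : A.G m → B.G n` for which the two increasing sequences of kernels in
`A.G m`, of the maps to the later groups of `A` and of `B`, are cofinal in each other. -/
def Intertwined (A B : SurjSeq.{u}) : Prop :=
  ∃ (m n : ℕ) (s : A.G m →* B.G n), Function.Surjective s ∧
    (∀ n' (h : n ≤ n'), ∃ (m' : ℕ) (h' : m ≤ m'), ∀ x, B.comp h (s x) = 1 → A.comp h' x = 1) ∧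
    (∀ m' (h : m ≤ m'), ∃ (n' : ℕ) (h' : n ≤ n'), ∀ x, A.comp h x = 1 → B.comp h' (s x) = 1)

/-- Read through `a 0` and `b 0`, the map `C.map 0` is the required `s`. The kernels of both
families become kernels of maps from `C.G 0`, at even stages for `A` and odd stages for `B`, so they
interlace. -/
theorem TailEquiv.intertwined {A B : SurjSeq.{u}} (hAB : TailEquiv A B) : Intertwined A B := by
  obtain ⟨p, q, hp, hq, C, a, b, ha, hb⟩ := hAB
  have hA : ∀ i (s : A.G (p 0)),
      C.comp (Nat.zero_le (2 * i)) (a 0 s) = a i (A.comp (hp.monotone (Nat.zero_le i)) s) := by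
    intro i s
    induction i with
    | zero => exact (comp_refl C 0 _).trans (congrArg (a 0) (comp_refl A _ s).symm)
    | succ i ih =>
      rw [← A.comp_comp (hp.monotone (Nat.zero_le i)) (hp.monotone (Nat.le_succ i)), ← ha, ← ih,
        ← comp_succ C (Nat.zero_le (2 * i)) (Nat.zero_le _), ← comp_succ C (Nat.zero_le _)]
  have hB : ∀ i (t : B.G (q 0)), C.comp (Nat.le_add_left 1 (2 * i)) (b 0 t) =
      b i (B.comp (hq.monotone (Nat.zero_le i)) t) := by
    intro i t
    induction i with
    | zero => exact (comp_refl C 1 _).trans (congrArg (b 0) (comp_refl B _ t).symm)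
    | succ i ih =>
      rw [← B.comp_comp (hq.monotone (Nat.zero_le i)) (hq.monotone (Nat.le_succ i)), ← hb, ← ih,
        ← comp_succ C (Nat.le_add_left 1 (2 * i)) (by omega), ← comp_succ C (by omega)]
  let s : A.G (p 0) →* B.G (q 0) :=
    (b 0).symm.toMonoidHom.comp ((C.map 0).comp (a 0).toMonoidHom)
  have hs : ∀ x, b 0 (s x) = C.map 0 (a 0 x) := fun x => (b 0).apply_symm_apply _
  have hBs : ∀ i x, C.comp (Nat.zero_le (2 * i + 1)) (a 0 x) =
      b i (B.comp (hq.monotone (Nat.zero_le i)) (s x)) := by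
    intro i x
    rw [← hB, hs, ← C.comp_comp (Nat.zero_le 1) (Nat.le_add_left 1 (2 * i)),
      comp_succ C (Nat.zero_le 0)]
    congr 2
  refine ⟨p 0, q 0, s, ?_, ?_, ?_⟩
  · exact (b 0).symm.surjective.comp ((C.surj 0).comp (a 0).surjective)
  · intro n' h
    -- `B.G (q n')` sits at stage `2 * n' + 1` of `C`, and `q n' ≥ n'`; the next stage belongs to
    -- `A.G (p (n' + 1))`.
    refine ⟨p (n' + 1), hp.monotone (Nat.zero_le _), fun x hx => ?_⟩
    have h1 := B.comp_eq_one_of_le (hq.le_apply (x := n')) hx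
    have h2 := hBs n' x
    rw [h1, map_one] at h2
    have h3 := C.comp_eq_one_of_le (Nat.le_succ _) h2
    exact (a (n' + 1)).map_eq_one_iff.1 ((hA (n' + 1) x).symm.trans h3)
  · intro m' h
    refine ⟨q m', hq.monotone (Nat.zero_le _), fun x hx => ?_⟩
    have h1 := A.comp_eq_one_of_le (hp.le_apply (x := m')) hx
    have h2 := hA m' x
    rw [h1, map_one] at h2
    have h3 := C.comp_eq_one_of_le (Nat.le_succ _) h2
    exact (b m').map_eq_one_iff.1 ((hBs m' x).symm.trans h3)

/-- The sequence of quotients of a group by an increasing sequence of normal subgroups. -/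
def quotients {K : Type u} [Group K] (N : ℕ → Subgroup K) [∀ i, (N i).Normal] (hN : Monotone N) :
    SurjSeq.{u} where
  G i := K ⧸ N i
  map i := QuotientGroup.map (N i) (N (i + 1)) (MonoidHom.id K) (hN (Nat.le_succ i))
  surj _ := QuotientGroup.map_surjective_of_surjective _ _ _
    (QuotientGroup.mk_surjective.comp Function.surjective_id) _

theorem Intertwined.tailEquiv {A B : SurjSeq.{u}} (hAB : Intertwined A B) : TailEquiv A B := by
  obtain ⟨m, n, s, hs, h1, h2⟩ := hAB
  let f (j : ℕ) : A.G m →* A.G (m + j) := A.comp (Nat.le_add_right m j)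
  let g (j : ℕ) : A.G m →* B.G (n + j) := (B.comp (Nat.le_add_right n j)).comp s
  have hf : ∀ j, Function.Surjective (f j) := fun j => A.comp_surjective _
  have hg : ∀ j, Function.Surjective (g j) := fun j => (B.comp_surjective _).comp hs
  have hα : ∀ j, ∃ k > j, (g j).ker ≤ (f k).ker := by
    intro j
    obtain ⟨m', hm, h⟩ := h1 (n + j) (Nat.le_add_right n j)
    -- Enlarging the index only enlarges the kernel; the excess over `j` makes the index sequences
    -- strictly increasing.
    refine ⟨m' + j + 1, by omega, fun x hx => ?_⟩
    exact A.comp_eq_one_of_le (h := hm) (by omega) (h x hx)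
  have hβ : ∀ j, ∃ k > j, (f j).ker ≤ (g k).ker := by
    intro j
    obtain ⟨n', hn, h⟩ := h2 (m + j) (Nat.le_add_right m j)
    refine ⟨n' + j + 1, by omega, fun x hx => ?_⟩
    exact B.comp_eq_one_of_le (h := hn) (by omega) (h x hx)
  choose α hα hgf using hα
  choose β hβ hfg using hβ
  -- Going back and forth gives `ker f (P i) ≤ ker g (β (P i)) ≤ ker f (P (i + 1))`. The quotients
  -- by this chain form the sequence `C`, by the first isomorphism theorem.
  let P : ℕ → ℕ := Nat.rec 0 fun _ k => α (β k)
  have hP : StrictMono P := strictMono_nat_of_lt_succ fun i => (hβ _).trans (hα _)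
  have hQ : StrictMono fun i => β (P i) := strictMono_nat_of_lt_succ fun i => (hα _).trans (hβ _)
  let N : ℕ → Subgroup (A.G m) := fun k =>
    if k % 2 = 0 then (f (P (k / 2))).ker else (g (β (P (k / 2)))).ker
  have hN0 : ∀ i, N (2 * i) = (f (P i)).ker := fun i => by
    dsimp only [N]
    rw [if_pos (by omega), show 2 * i / 2 = i by omega]
  have hN1 : ∀ i, N (2 * i + 1) = (g (β (P i))).ker := fun i => by
    dsimp only [N]
    rw [if_neg (by omega), show (2 * i + 1) / 2 = i by omega]
  have hNn : ∀ k, (N k).Normal := fun k => by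
    dsimp only [N]
    split_ifs <;> infer_instance
  have hN : Monotone N := by
    refine monotone_nat_of_le_succ fun k => ?_
    obtain ⟨i, rfl | rfl⟩ := Nat.even_or_odd' k
    · rw [hN0, hN1]
      exact hfg _
    · rw [hN1, show 2 * i + 1 + 1 = 2 * (i + 1) by ring, hN0]
      exact hgf _
  let a (i : ℕ) : A.G (m + P i) ≃* (A.G m ⧸ N (2 * i)) :=
    ((QuotientGroup.quotientMulEquivOfEq (hN0 i)).trans
      (QuotientGroup.quotientKerEquivOfSurjective (f (P i)) (hf _))).symm
  have ha : ∀ i x, a i (f (P i) x) = QuotientGroup.mk x := by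
    intro i x
    rw [MulEquiv.symm_apply_eq]
    rfl
  let b (i : ℕ) : B.G (n + β (P i)) ≃* (A.G m ⧸ N (2 * i + 1)) :=
    ((QuotientGroup.quotientMulEquivOfEq (hN1 i)).trans
      (QuotientGroup.quotientKerEquivOfSurjective (g (β (P i))) (hg _))).symm
  have hb : ∀ i x, b i (g (β (P i)) x) = QuotientGroup.mk x := by
    intro i x
    rw [MulEquiv.symm_apply_eq]
    rfl
  refine ⟨fun i => m + P i, fun i => n + β (P i), fun _ _ h => Nat.add_lt_add_left (hP h) m,
    fun _ _ h => Nat.add_lt_add_left (hQ h) n, quotients N hN, a, b, fun i t => ?_, fun i t => ?_⟩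
  · obtain ⟨x, rfl⟩ := hf _ t
    rw [show A.comp _ (f (P i) x) = f (P (i + 1)) x from A.comp_comp _ _ _ x]
    exact (congrArg _ (congrArg _ (ha i x))).trans (ha (i + 1) x).symm
  · obtain ⟨x, rfl⟩ := hg _ t
    rw [show B.comp _ (g (β (P i)) x) = g (β (P (i + 1))) x from B.comp_comp _ _ _ (s x)]
    exact (congrArg _ (congrArg _ (hb i x))).trans (hb (i + 1) x).symm

/-- A homomorphism that kills the kernel of a surjective homomorphism factors through it. -/
theorem exists_factor {K L M : Type u} [Group K] [Group L] [Group M] (f : K →* L)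
    (hf : Function.Surjective f) (g : K →* M) (h : ∀ x, f x = 1 → g x = 1) :
    ∃ t : L →* M, ∀ x, t (f x) = g x :=
  ⟨f.liftOfSurjective hf ⟨g, fun x hx => h x hx⟩, fun x =>
    MonoidHom.liftOfRightInverse_comp_apply f _ _ ⟨g, fun x hx => h x hx⟩ x⟩

/-- The surjection `s` need not be invertible, but its kernel dies at some stage `k` of `A`. The map
`A.G m →* A.G k` therefore factors through `s`, and the factor `t` is the surjection in the other
direction. -/
theorem Intertwined.symm {A B : SurjSeq.{u}} (hAB : Intertwined A B) : Intertwined B A := by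
  obtain ⟨m, n, s, hs, h1, h2⟩ := hAB
  obtain ⟨k, hk, hsk⟩ := h1 n le_rfl
  obtain ⟨t, ht⟩ := exists_factor s hs (A.comp hk) fun x hx => hsk x (by rw [hx, map_one])
  refine ⟨n, k, t, fun y => ?_, fun n' h => ?_, fun m' h => ?_⟩
  · obtain ⟨x, rfl⟩ := A.comp_surjective hk y
    exact ⟨s x, ht x⟩
  · obtain ⟨m', hm', H⟩ := h2 n' (hk.trans h)
    refine ⟨m', hm', fun y hy => ?_⟩
    obtain ⟨x, rfl⟩ := hs y
    rw [ht, A.comp_comp hk h (hk.trans h)] at hy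
    exact H x hy
  · obtain ⟨n', hn', H⟩ := h1 m' h
    refine ⟨n' + k, by omega, fun y hy => ?_⟩
    obtain ⟨x, rfl⟩ := hs y
    rw [ht, A.comp_comp hk _ (by omega)]
    exact A.comp_eq_one_of_le (h := hn') (by omega) (H x hy)

theorem Intertwined.trans {A B D : SurjSeq.{u}} (hAB : Intertwined A B) (hBD : Intertwined B D) :
    Intertwined A D := by
  obtain ⟨m, n, s, hs, h1, h2⟩ := hAB
  obtain ⟨n', k, t, ht, h3, h4⟩ := hBD
  -- The target of `s` and the source of `t` have different indices in `B`. Both are pushed to `n +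
  -- n'`, where `t` descends to `r` once its values are moved on to stage `k'` of `D`.
  obtain ⟨k', hk', H⟩ := h4 (n + n') (by omega)
  obtain ⟨r, hr⟩ := exists_factor (B.comp (show n' ≤ n + n' by omega)) (B.comp_surjective _)
    ((D.comp hk').comp t) H
  have hn : n ≤ n + n' := by omega
  refine ⟨m, k', r.comp ((B.comp hn).comp s), ?_, fun l h => ?_, fun l h => ?_⟩
  · have hr' : Function.Surjective r := fun z => by
      obtain ⟨w, rfl⟩ := D.comp_surjective hk' z
      obtain ⟨y, rfl⟩ := ht w
      exact ⟨_, hr y⟩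
    exact hr'.comp ((B.comp_surjective hn).comp hs)
  · obtain ⟨l', hl', H1⟩ := h3 l (hk'.trans h)
    obtain ⟨m', hm', H2⟩ := h1 (n + n' + l') (by omega)
    refine ⟨m', hm', fun x hx => H2 x ?_⟩
    obtain ⟨y, hy⟩ := B.comp_surjective (show n' ≤ n + n' by omega) (B.comp hn (s x))
    have h5 : D.comp h (r (B.comp hn (s x))) = 1 := hx
    rw [← hy, hr] at h5
    have h6 := H1 y ((D.comp_comp hk' h _ _).symm.trans h5)
    have h7 := B.comp_eq_one_of_le (show l' ≤ n + n' + l' by omega) h6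
    have h8 : B.comp (show n + n' ≤ n + n' + l' by omega) (B.comp hn (s x)) = 1 := by
      rw [← hy, B.comp_comp _ _ (by omega), h7]
    rwa [B.comp_comp hn _ (by omega)] at h8
  · obtain ⟨l', hl', H1⟩ := h2 l h
    obtain ⟨k'', hk'', H2⟩ := h4 (l' + n + n') (by omega)
    refine ⟨k'' + k', by omega, fun x hx => ?_⟩
    obtain ⟨y, hy⟩ := B.comp_surjective (show n' ≤ n + n' by omega) (B.comp hn (s x))
    have h5 := B.comp_eq_one_of_le (show l' ≤ l' + n + n' by omega) (H1 x hx)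
    rw [← B.comp_comp hn (show n + n' ≤ l' + n + n' by omega), ← hy,
      B.comp_comp _ _ (by omega)] at h5
    have h6 := D.comp_eq_one_of_le (show k'' ≤ k'' + k' by omega) (H2 y h5)
    change D.comp _ (r (B.comp hn (s x))) = 1
    rw [← hy, hr]
    exact (D.comp_comp hk' _ _ _).trans h6

theorem TailEquiv.symm {A B : SurjSeq.{u}} (h : TailEquiv A B) : TailEquiv B A :=
  h.intertwined.symm.tailEquiv

theorem TailEquiv.trans {A B D : SurjSeq.{u}} (h : TailEquiv A B) (h' : TailEquiv B D) :
    TailEquiv A D :=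
  (h.intertwined.trans h'.intertwined).tailEquiv

theorem TailEquiv.asymptoticClass_eq {A B : SurjSeq.{u}} (h : TailEquiv A B) :
    A.asymptoticClass = B.asymptoticClass :=
  Set.ext fun _ => ⟨fun hA => h.symm.trans hA, fun hB => h.trans hB⟩

end SurjSeq

/-! ### Words, and closure of `𝒢*` under composition and inversion -/

namespace PseudogroupAction

section Words

variable {X : Type u} [TopologicalSpace X] (Φ : PseudogroupAction X)

theorem word_source_subset (i : Fin Φ.ν) (l : List (Fin Φ.ν)) (hl : List.IsChain Φ.adm (i :: l)) :
    (Φ.word i l).source ⊆ Φ.T i := by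
  cases l with
  | nil => exact (Φ.source_refl i).subset
  | cons j l =>
    rw [List.isChain_cons_cons] at hl
    exact inter_subset_left.trans (Φ.source_subset i j hl.1)

theorem target_subset {i j : Fin Φ.ν} (hij : Φ.adm i j) : (Φ.h i j).target ⊆ Φ.T j := by
  have h := (Φ.symm_h i j hij).1
  exact (show (Φ.h i j).target = (Φ.h j i).source from h).subset.trans
    (Φ.source_subset j i (Φ.adm_symm i j hij))

theorem word_mapsTo (i : Fin Φ.ν) (l : List (Fin Φ.ν)) (hl : List.IsChain Φ.adm (i :: l))
    {x : X} (hx : x ∈ (Φ.word i l).source) :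
    Φ.word i l x ∈ Φ.T ((i :: l).getLast (List.cons_ne_nil i l)) := by
  induction l generalizing i x with
  | nil =>
    have : x ∈ Φ.T i := Φ.source_refl i ▸ hx
    change Φ.h i i x ∈ Φ.T i
    rwa [Φ.h_refl i x this]
  | cons j l ih =>
    rw [List.isChain_cons_cons] at hl
    exact ih j hl.2 hx.2

theorem refl_trans_eqOnSource {Y : Type v} [TopologicalSpace Y] (i : Fin Φ.ν)
    (g : OpenPartialHomeomorph X Y) (hg : g.source ⊆ Φ.T i) : (Φ.h i i).trans g ≈ g := by
  refine ⟨?_, ?_⟩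
  · ext x
    change x ∈ (Φ.h i i).source ∩ Φ.h i i ⁻¹' g.source ↔ x ∈ g.source
    rw [Φ.source_refl]
    constructor
    · rintro ⟨h1, h2⟩
      rwa [mem_preimage, Φ.h_refl i x h1] at h2
    · intro h
      exact ⟨hg h, by rwa [mem_preimage, Φ.h_refl i x (hg h)]⟩
  · intro x hx
    have : x ∈ Φ.T i := Φ.source_refl i ▸ hx.1
    change g (Φ.h i i x) = g x
    rw [Φ.h_refl i x this]

theorem trans_refl_eqOnSource (i : Fin Φ.ν) (g : OpenPartialHomeomorph X X)
    (hg : g.target ⊆ Φ.T i) : g.trans (Φ.h i i) ≈ g := by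
  refine ⟨?_, ?_⟩
  · change g.source ∩ g ⁻¹' (Φ.h i i).source = g.source
    rw [Φ.source_refl, inter_eq_left]
    exact fun x hx => hg (g.map_source hx)
  · intro x hx
    exact Φ.h_refl i _ (hg (g.map_source hx.1))

/-- A word ends with the identity of its last piece, and this is absorbed by the next word, whose
domain lies in that piece. -/
theorem word_append (i : Fin Φ.ν) (l l' : List (Fin Φ.ν)) (hl : List.IsChain Φ.adm (i :: l))
    (hl' : List.IsChain Φ.adm ((i :: l).getLast (List.cons_ne_nil i l) :: l')) :
    Φ.word i (l ++ l') ≈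
      (Φ.word i l).trans (Φ.word ((i :: l).getLast (List.cons_ne_nil i l)) l') := by
  induction l generalizing i with
  | nil => exact Setoid.symm (Φ.refl_trans_eqOnSource i _ (Φ.word_source_subset i l' hl'))
  | cons j l ih =>
    rw [List.isChain_cons_cons] at hl
    change (Φ.h i j).trans (Φ.word j (l ++ l')) ≈ ((Φ.h i j).trans (Φ.word j l)).trans _
    rw [OpenPartialHomeomorph.trans_assoc]
    exact OpenPartialHomeomorph.EqOnSource.trans' (Setoid.refl _) (ih j hl.2 hl')

theorem isChain_append {i : Fin Φ.ν} {l l' : List (Fin Φ.ν)} (hl : List.IsChain Φ.adm (i :: l))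
    (hl' : List.IsChain Φ.adm ((i :: l).getLast (List.cons_ne_nil i l) :: l')) :
    List.IsChain Φ.adm (i :: (l ++ l')) := by
  induction l generalizing i with
  | nil => exact hl'
  | cons j l ih =>
    rw [List.isChain_cons_cons] at hl
    rw [List.cons_append, List.isChain_cons_cons]
    exact ⟨hl.1, ih hl.2 hl'⟩

theorem getLast_cons_append (i : Fin Φ.ν) (l l' : List (Fin Φ.ν)) (j : Fin Φ.ν)
    (hj : j = (i :: l).getLast (List.cons_ne_nil i l)) :
    (i :: (l ++ l')).getLast (List.cons_ne_nil _ _) =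
      (j :: l').getLast (List.cons_ne_nil _ _) := by
  subst hj
  induction l generalizing i with
  | nil => rfl
  | cons k l ih => exact ih k

theorem word_pair {i j : Fin Φ.ν} (hij : Φ.adm i j) : Φ.word i [j] ≈ Φ.h i j :=
  Φ.trans_refl_eqOnSource j _ (Φ.target_subset hij)

/-- The sequence is reversed. Its last index is recorded so that the induction can append one more
generator. -/
theorem exists_word_symm (i : Fin Φ.ν) (l : List (Fin Φ.ν)) (hl : List.IsChain Φ.adm (i :: l)) :
    ∃ (j : Fin Φ.ν) (l' : List (Fin Φ.ν)), List.IsChain Φ.adm (j :: l') ∧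
      (j :: l').getLast (List.cons_ne_nil j l') = i ∧ Φ.word j l' ≈ (Φ.word i l).symm := by
  induction l generalizing i with
  | nil => exact ⟨i, [], List.isChain_singleton _, rfl,
      Setoid.symm (Φ.symm_h i i (Φ.adm_refl i))⟩
  | cons k l ih =>
    rw [List.isChain_cons_cons] at hl
    obtain ⟨j, l', hl', hk, hw⟩ := ih k hl.2
    have hki := Φ.adm_symm i k hl.1
    have hc : List.IsChain Φ.adm ((j :: l').getLast (List.cons_ne_nil j l') :: [i]) := by
      rw [hk, List.isChain_cons_cons]
      exact ⟨hki, List.isChain_singleton _⟩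
    refine ⟨j, l' ++ [i], Φ.isChain_append hl' hc, ?_, ?_⟩
    · rw [Φ.getLast_cons_append j l' [i] _ rfl]
      rfl
    · refine Setoid.trans (Φ.word_append j l' [i] hl' hc) ?_
      rw [hk]
      change _ ≈ (Φ.word k l).symm.trans (Φ.h i k).symm
      exact OpenPartialHomeomorph.EqOnSource.trans' hw
        (Setoid.trans (Φ.word_pair hki) (Setoid.symm (Φ.symm_h i k hl.1)))

variable {Φ}

theorem Star.mono {g g' : OpenPartialHomeomorph X X} (hg : Φ.Star g)
    (hs : g'.source ⊆ g.source) (he : ∀ x ∈ g'.source, g' x = g x) : Φ.Star g' := by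
  obtain ⟨i, l, hl, hne, hsub, heq⟩ := hg
  exact ⟨i, l, hl, hne, hs.trans hsub, fun x hx => (he x hx).trans (heq x (hs hx))⟩

theorem star_word {i : Fin Φ.ν} {l : List (Fin Φ.ν)} (hl : List.IsChain Φ.adm (i :: l))
    (hne : (Φ.word i l).source.Nonempty) : Φ.Star (Φ.word i l) :=
  ⟨i, l, hl, hne, subset_rfl, fun _ _ => rfl⟩

theorem star_refl (i : Fin Φ.ν) : Φ.Star (Φ.h i i) :=
  star_word (l := []) (List.isChain_singleton i) (Φ.source_nonempty i i (Φ.adm_refl i))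

theorem Star.of_source_eq_empty {g g' : OpenPartialHomeomorph X X} (hg : Φ.Star g)
    (h : g'.source = ∅) : Φ.Star g' :=
  hg.mono (by simp [h]) (by simp [h])

/-- If the composition has a point in its domain, disjointness of the pieces forces the first word
to end where the second begins, so the two concatenate. An empty composition is a restriction of
anything. -/
theorem Star.trans {g g' : OpenPartialHomeomorph X X} (hg : Φ.Star g) (hg' : Φ.Star g') :
    Φ.Star (g.trans g') := by
  rcases (g.trans g').source.eq_empty_or_nonempty with h | ⟨x, hx⟩
  · exact hg.of_source_eq_empty h
  obtain ⟨i, l, hl, -, hs, he⟩ := hg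
  obtain ⟨j, l', hl', -, hs', he'⟩ := hg'
  have key : ∀ y ∈ (g.trans g').source, y ∈ ((Φ.word i l).trans (Φ.word j l')).source := by
    intro y hy
    exact ⟨hs hy.1, by rw [mem_preimage]; exact he y hy.1 ▸ hs' hy.2⟩
  have hj : (i :: l).getLast (List.cons_ne_nil i l) = j := by
    by_contra hne
    exact disjoint_left.1 (Φ.disjoint_T _ _ hne) (Φ.word_mapsTo i l hl (key x hx).1)
      (Φ.word_source_subset j l' hl' (key x hx).2)
  subst hj
  have hw := Φ.word_append i l l' hl hl'
  refine ⟨i, l ++ l', Φ.isChain_append hl hl', ?_, fun y hy => hw.1.superset (key y hy),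
    fun y hy => ?_⟩
  · exact ⟨x, hw.1.superset (key x hx)⟩
  · rw [hw.2 (hw.1.superset (key y hy))]
    change g' (g y) = Φ.word _ l' (Φ.word i l y)
    rw [he' (g y) hy.2, he y hy.1]

theorem Star.symm {g : OpenPartialHomeomorph X X} (hg : Φ.Star g) : Φ.Star g.symm := by
  obtain ⟨i, l, hl, hne, hs, he⟩ := hg
  obtain ⟨j, l', hl', -, hw⟩ := Φ.exists_word_symm i l hl
  have hsrc : (Φ.word j l').source = (Φ.word i l).target := hw.1
  have key : ∀ y ∈ g.target, y ∈ (Φ.word i l).target ∧ g.symm y = (Φ.word i l).symm y := by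
    intro y hy
    have h1 := g.map_target hy
    have h2 := he _ h1
    rw [g.right_inv hy] at h2
    have h3 := (Φ.word i l).map_source (hs h1)
    have h4 := (Φ.word i l).left_inv (hs h1)
    rw [← h2] at h3 h4
    exact ⟨h3, h4.symm⟩
  refine ⟨j, l', hl', ?_, fun y hy => hsrc.superset (key y hy).1, fun y hy => ?_⟩
  · rw [hsrc, ← (Φ.word i l).image_source_eq_target]
    exact hne.image _
  · rw [(key y hy).2, hw.2 (hsrc.superset (key y hy).1)]

theorem Star.restr {g : OpenPartialHomeomorph X X} (hg : Φ.Star g) {s : Set X} (hs : IsOpen s) :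
    Φ.Star (g.restr s) := by
  refine hg.mono ?_ fun x _ => rfl
  rw [g.restr_source' _ hs]
  exact inter_subset_left

end Words

end PseudogroupAction

/-! ### Cells and the existence of adapted neighborhood bases -/

theorem IsClopen.exists_radius {X : Type u} [MetricSpace X] [CompactSpace X] {W : Set X}
    (hW : IsClopen W) : ∃ r > 0, ∀ x ∈ W, Metric.ball x r ⊆ W := by
  obtain ⟨r, hr, h⟩ := hW.isClosed.isCompact.exists_thickening_subset_open hW.isOpen subset_rfl
  exact ⟨r, hr, fun x hx => (Metric.ball_subset_thickening hx r).trans h⟩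

/-- The restriction of a local homeomorphism to an invariant set. -/
def OpenPartialHomeomorph.homeomorphOfMapsTo {X : Type u} [TopologicalSpace X]
    (g : OpenPartialHomeomorph X X) (U : Set X) (hs : U ⊆ g.source) (h : MapsTo g U U)
    (ht : U ⊆ g.target) (h' : MapsTo g.symm U U) : U ≃ₜ U where
  toFun := h.restrict g U U
  invFun := h'.restrict g.symm U U
  left_inv u := Subtype.ext (g.left_inv (hs u.2))
  right_inv u := Subtype.ext (g.right_inv (ht u.2))
  continuous_toFun := (g.continuousOn.mono hs).mapsToRestrict h
  continuous_invFun := (g.continuousOn_symm.mono ht).mapsToRestrict h'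

namespace PseudogroupAction

section Cells

variable {X : Type u} [TopologicalSpace X] {Φ : PseudogroupAction X}

/-- The points that are not distinguished from `x` by the domains of the words and by the preimages
of `W` under the words. -/
def cell (Φ : PseudogroupAction X) (W : Set X) (x : X) : Set X :=
  {y | ∀ (i : Fin Φ.ν) (l : List (Fin Φ.ν)), List.IsChain Φ.adm (i :: l) →
    (x ∈ (Φ.word i l).source ↔ y ∈ (Φ.word i l).source) ∧
    (x ∈ (Φ.word i l).source ∧ Φ.word i l x ∈ W ↔ y ∈ (Φ.word i l).source ∧ Φ.word i l y ∈ W)}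

theorem mem_cell_self (W : Set X) (x : X) : x ∈ Φ.cell W x := fun _ _ _ => ⟨Iff.rfl, Iff.rfl⟩

theorem cell_eq {W : Set X} {x y : X} (h : y ∈ Φ.cell W x) : Φ.cell W y = Φ.cell W x := by
  ext z
  exact ⟨fun hz i l hl => ⟨(h i l hl).1.trans (hz i l hl).1, (h i l hl).2.trans (hz i l hl).2⟩,
    fun hz i l hl => ⟨(h i l hl).1.symm.trans (hz i l hl).1,
      (h i l hl).2.symm.trans (hz i l hl).2⟩⟩

/-- The one-letter word at the piece containing `x` is an identity, so its clause about `W` compares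
membership in `W` itself. -/
theorem cell_subset {W : Set X} {x : X} (hx : x ∈ W) : Φ.cell W x ⊆ W := by
  intro y hy
  have hxi : x ∈ ⋃ i, Φ.T i := Φ.iUnion_T ▸ mem_univ x
  obtain ⟨i, hi⟩ := mem_iUnion.1 hxi
  have hw : ∀ z ∈ (Φ.word i []).source, Φ.word i [] z = z := fun z hz =>
    Φ.h_refl i z ((Φ.source_refl i).subset hz)
  have hxs : x ∈ (Φ.word i []).source := (Φ.source_refl i).superset hi
  have h := (hy i [] (List.isChain_singleton i)).2.1 ⟨hxs, by rwa [hw x hxs]⟩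
  rw [hw y h.1] at h
  exact h.2

/-- A test word applied after `Φ.word i l` is the concatenated word, which already fails to separate
`x` from `y`. If the indices do not match, neither image lies in the domain of the test word. -/
theorem word_mem_cell {W : Set X} {x y : X} {i : Fin Φ.ν} {l : List (Fin Φ.ν)}
    (hl : List.IsChain Φ.adm (i :: l)) (hx : x ∈ (Φ.word i l).source) (hy : y ∈ Φ.cell W x) :
    Φ.word i l y ∈ Φ.cell W (Φ.word i l x) := by
  have hys := (hy i l hl).1.1 hx
  intro j l' hl'
  by_cases hj : (i :: l).getLast (List.cons_ne_nil i l) = j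
  · subst hj
    have hw := Φ.word_append i l l' hl hl'
    have key : ∀ z ∈ (Φ.word i l).source, (z ∈ (Φ.word i (l ++ l')).source ↔
        Φ.word i l z ∈ (Φ.word ((i :: l).getLast (List.cons_ne_nil i l)) l').source) ∧
        (z ∈ (Φ.word i (l ++ l')).source ∧ Φ.word i (l ++ l') z ∈ W ↔
        Φ.word i l z ∈ (Φ.word ((i :: l).getLast (List.cons_ne_nil i l)) l').source ∧
          Φ.word ((i :: l).getLast (List.cons_ne_nil i l)) l' (Φ.word i l z) ∈ W) := by
      intro z hz
      have h1 : z ∈ (Φ.word i (l ++ l')).source ↔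
          Φ.word i l z ∈ (Φ.word ((i :: l).getLast (List.cons_ne_nil i l)) l').source :=
        ⟨fun h => (hw.1.subset h).2, fun h => hw.1.superset ⟨hz, h⟩⟩
      have h2 : z ∈ (Φ.word i (l ++ l')).source → Φ.word i (l ++ l') z =
          Φ.word ((i :: l).getLast (List.cons_ne_nil i l)) l' (Φ.word i l z) := fun h => hw.2 h
      exact ⟨h1, ⟨fun h => ⟨h1.1 h.1, h2 h.1 ▸ h.2⟩, fun h => ⟨h1.2 h.1, h2 (h1.2 h.1) ▸ h.2⟩⟩⟩
    have h := hy i (l ++ l') (Φ.isChain_append hl hl')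
    exact ⟨(key x hx).1.symm.trans (h.1.trans (key y hys).1),
      (key x hx).2.symm.trans (h.2.trans (key y hys).2)⟩
  · have key : ∀ z ∈ (Φ.word i l).source, Φ.word i l z ∉ (Φ.word j l').source := fun z hz h =>
      disjoint_left.1 (Φ.disjoint_T _ _ hj) (Φ.word_mapsTo i l hl hz)
        (Φ.word_source_subset j l' hl' h)
    simp [key x hx, key y hys]

theorem word_symm_mem_cell {W : Set X} {x y : X} {i : Fin Φ.ν} {l : List (Fin Φ.ν)}
    (hl : List.IsChain Φ.adm (i :: l)) (hx : x ∈ (Φ.word i l).target) (hy : y ∈ Φ.cell W x) :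
    y ∈ (Φ.word i l).target ∧ (Φ.word i l).symm y ∈ Φ.cell W ((Φ.word i l).symm x) := by
  obtain ⟨j, l', hl', -, hw⟩ := Φ.exists_word_symm i l hl
  have hx' := hw.1.superset hx
  have hy' := (hy j l' hl').1.1 hx'
  rw [← hw.2 hx', ← hw.2 hy']
  exact ⟨hw.1.subset hy', word_mem_cell hl' hx' hy⟩

/-- The homeomorphisms of `U` that belong to the pseudo⋆group. -/
def starSubgroup (Φ : PseudogroupAction X) (U : Set X)
    (hΦU : ∃ g : OpenPartialHomeomorph X X, Φ.Star g ∧ U ⊆ g.source ∧ ∀ x ∈ U, g x = x) :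
    Subgroup (U ≃ₜ U) where
  carrier := {h | ∃ g, Φ.Star g ∧ U ⊆ g.source ∧ ∀ u : U, g u = (h u : X)}
  one_mem' := by
    obtain ⟨g, hg, hs, h⟩ := hΦU
    exact ⟨g, hg, hs, fun u => h u u.2⟩
  mul_mem' := by
    rintro a b ⟨g, hg, hs, h⟩ ⟨g', hg', hs', h'⟩
    refine ⟨g'.trans g, hg'.trans hg, fun x hx => ⟨hs' hx, hs ?_⟩, fun u => ?_⟩
    · exact (h' ⟨x, hx⟩) ▸ (b ⟨x, hx⟩).2
    · change g (g' u) = a (b u)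
      rw [h', h]
  inv_mem' := by
    rintro a ⟨g, hg, hs, h⟩
    have key : ∀ u : U, (u : X) ∈ g.target ∧ g.symm u = (a.symm u : X) := by
      intro u
      have h1 := h (a.symm u)
      rw [a.apply_symm_apply] at h1
      rw [← h1]
      exact ⟨g.map_source (hs (a.symm u).2), g.left_inv (hs (a.symm u).2)⟩
    exact ⟨g.symm, hg.symm, fun x hx => (key ⟨x, hx⟩).1, fun u => (key u).2⟩

end Cells

variable {X : Type u} [MetricSpace X] [CompactSpace X] {Φ : PseudogroupAction X}

theorem exists_radius_source (Φ : PseudogroupAction X) :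
    ∃ r > 0, ∀ i j, Φ.adm i j → ∀ x ∈ (Φ.h i j).source,
      Metric.ball x r ⊆ (Φ.h i j).source := by
  have h : ∀ᶠ r in 𝓝[>] (0 : ℝ), ∀ i j, Φ.adm i j → ∀ x ∈ (Φ.h i j).source,
      Metric.ball x r ⊆ (Φ.h i j).source := by
    rw [eventually_all]
    intro i
    rw [eventually_all]
    intro j
    by_cases hij : Φ.adm i j
    · obtain ⟨r, hr, h⟩ := (Φ.isClopen_source i j hij).exists_radius
      filter_upwards [Ioo_mem_nhdsGT hr] with s hs _ x hx
      exact (Metric.ball_subset_ball hs.2.le).trans (h x hx)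
    · exact Eventually.of_forall fun r h => absurd h hij
  obtain ⟨r, h, hr⟩ := (h.and self_mem_nhdsWithin).exists
  exact ⟨r, hr, h⟩

/-- The domains of the words of an equicontinuous action contain balls of a uniform radius. -/
theorem Equicontinuous.exists_radius_word (hΦ : Φ.Equicontinuous) :
    ∃ δ > 0, ∀ (i : Fin Φ.ν) (l : List (Fin Φ.ν)), List.IsChain Φ.adm (i :: l) →
      ∀ x ∈ (Φ.word i l).source, Metric.ball x δ ⊆ (Φ.word i l).source := by
  obtain ⟨r, hr, hsrc⟩ := Φ.exists_radius_source
  obtain ⟨δ, hδ, heq⟩ := hΦ r hr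
  refine ⟨min r δ, lt_min hr hδ, fun i l => ?_⟩
  -- Generators are added at the end: equicontinuity of the word built so far keeps images of
  -- `δ`-close points `r`-close, hence inside the domain of the last generator. So the radius does
  -- not shrink with the length.
  induction l using List.reverseRecOn with
  | nil =>
    exact fun _ x hx => (Metric.ball_subset_ball (min_le_left _ _)).trans
      (hsrc i i (Φ.adm_refl i) x hx)
  | append_singleton l k ih =>
    intro hc x hx y hy
    obtain ⟨hl, -, hk⟩ := List.isChain_append.1 (show List.IsChain Φ.adm ((i :: l) ++ [k]) from hc)
    have hlk := hk _ (List.getLast_mem_getLast? (List.cons_ne_nil i l)) k (by simp)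
    have hw := Setoid.trans (Φ.word_append i l [k] hl
      (List.isChain_cons_cons.2 ⟨hlk, List.isChain_singleton _⟩))
      (OpenPartialHomeomorph.EqOnSource.trans' (Setoid.refl _) (Φ.word_pair hlk))
    have hx' := hw.1.subset hx
    refine hw.1.superset ⟨ih hl x hx'.1 hy, hsrc _ _ hlk _ hx'.2 ?_⟩
    exact heq _ (star_word hl ⟨x, hx'.1⟩) y (ih hl x hx'.1 hy) x hx'.1
      (lt_of_lt_of_le hy (min_le_right _ _))

theorem Equicontinuous.exists_ball_subset_cell (hΦ : Φ.Equicontinuous) {W : Set X}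
    (hW : IsClopen W) : ∃ δ > 0, ∀ x, Metric.ball x δ ⊆ Φ.cell W x := by
  obtain ⟨r, hr, hrW⟩ := hW.exists_radius
  obtain ⟨δ₁, hδ₁, hsrc⟩ := hΦ.exists_radius_word
  obtain ⟨δ₂, hδ₂, heq⟩ := hΦ r hr
  have key : ∀ x y, dist x y < min δ₁ δ₂ → ∀ (i : Fin Φ.ν) (l : List (Fin Φ.ν)),
      List.IsChain Φ.adm (i :: l) → y ∈ (Φ.word i l).source →
      x ∈ (Φ.word i l).source ∧ (Φ.word i l y ∈ W → Φ.word i l x ∈ W) := by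
    intro x y hxy i l hl hy
    have hx := hsrc i l hl y hy (lt_of_lt_of_le hxy (min_le_left _ _))
    exact ⟨hx, fun h => hrW _ h (heq _ (star_word hl ⟨x, hx⟩) x hx y hy
      (lt_of_lt_of_le hxy (min_le_right _ _)))⟩
  refine ⟨min δ₁ δ₂, lt_min hδ₁ hδ₂, fun x y hy i l hl => ?_⟩
  have h1 := key y x hy i l hl
  have h2 := key x y (by rwa [dist_comm]) i l hl
  exact ⟨⟨fun h => (h1 h).1, fun h => (h2 h).1⟩, ⟨fun h => ⟨(h1 h.1).1, (h1 h.1).2 h.2⟩,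
    fun h => ⟨(h2 h.1).1, (h2 h.1).2 h.2⟩⟩⟩

/-- Cells partition `X`, and each contains a ball of one fixed radius about each of its points; so a
cell and its complement are both open. -/
theorem Equicontinuous.isClopen_cell (hΦ : Φ.Equicontinuous) {W : Set X} (hW : IsClopen W)
    (x : X) : IsClopen (Φ.cell W x) := by
  obtain ⟨δ, hδ, h⟩ := hΦ.exists_ball_subset_cell hW
  refine ⟨⟨Metric.isOpen_iff.2 fun y hy => ⟨δ, hδ, fun z hz hzx => hy ?_⟩⟩,
    Metric.isOpen_iff.2 fun y hy => ⟨δ, hδ, fun z hz => ?_⟩⟩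
  · rw [← cell_eq hzx, cell_eq (h y hz)]
    exact mem_cell_self W y
  · rw [← cell_eq hy]
    exact h y hz

/-- Cells are adapted. -/
theorem Equicontinuous.exists_adaptedSet_cell (hΦ : Φ.Equicontinuous) {W : Set X}
    (hW : IsClopen W) (x : X) : ∃ U : Φ.AdaptedSet, U.carrier = Φ.cell W x := by
  have hone : ∃ g : OpenPartialHomeomorph X X, Φ.Star g ∧ Φ.cell W x ⊆ g.source ∧
      ∀ y ∈ Φ.cell W x, g y = y := by
    have hxi : x ∈ ⋃ i, Φ.T i := Φ.iUnion_T ▸ mem_univ x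
    obtain ⟨i, hi⟩ := mem_iUnion.1 hxi
    have hs : Φ.cell W x ⊆ Φ.T i := fun y hy => (Φ.source_refl i).subset
      ((hy i [] (List.isChain_singleton i)).1.1 ((Φ.source_refl i).superset hi))
    exact ⟨Φ.h i i, star_refl i, (Φ.source_refl i).symm ▸ hs, fun y hy => Φ.h_refl i y (hs hy)⟩
  refine ⟨⟨Φ.cell W x, hΦ.isClopen_cell hW x,
    starSubgroup Φ _ hone, fun g => ⟨fun hg => ⟨hg.2.1, ?_⟩, ?_⟩, ?_⟩, rfl⟩
  · rcases g.source.eq_empty_or_nonempty with h | ⟨u, hu⟩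
    · exact ⟨1, Subgroup.one_mem _, by simp [h]⟩
    obtain ⟨⟨i, l, hl, hne, hs, he⟩, h1, h2⟩ := hg
    have hcu := cell_eq (h1 hu)
    -- One point of the cell returning to it suffices: the word is then defined on the whole cell
    -- and maps it onto itself.
    have hcw : Φ.cell W (Φ.word i l u) = Φ.cell W x := by
      rw [← he u hu]
      exact cell_eq (h2 (g.map_source hu))
    have hsrc : Φ.cell W x ⊆ (Φ.word i l).source := by
      rw [← hcu]
      exact fun y hy => (hy i l hl).1.1 (hs hu)
    have hinv : ∀ y ∈ Φ.cell W x, y ∈ (Φ.word i l).target ∧ (Φ.word i l).symm y ∈ Φ.cell W x := by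
      intro y hy
      rw [← hcw] at hy
      have := word_symm_mem_cell hl ((Φ.word i l).map_source (hs hu)) hy
      rwa [(Φ.word i l).left_inv (hs hu), hcu] at this
    refine ⟨(Φ.word i l).homeomorphOfMapsTo _ hsrc (fun y hy => ?_) (fun y hy => (hinv y hy).1)
      fun y hy => (hinv y hy).2, ⟨Φ.word i l, star_word hl hne, hsrc, fun _ => rfl⟩,
      fun y hy => he y hy⟩
    rw [← hcw]
    rw [← hcu] at hy
    exact word_mem_cell hl (hs hu) hy
  · rintro ⟨hs, h, ⟨k, hk, hks, hkh⟩, hgh⟩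
    refine ⟨hk.mono (hs.trans hks) fun y hy => ?_, hs, ?_⟩
    · exact (hgh ⟨y, hs hy⟩ hy).trans (hkh ⟨y, hs hy⟩).symm
    · rw [← g.image_source_eq_target]
      rintro _ ⟨y, hy, rfl⟩
      rw [hgh ⟨y, hs hy⟩ hy]
      exact (h ⟨y, hs hy⟩).2
  · rintro g ⟨i, l, hl, hne, hs, he⟩ hsub
    by_cases hd : Disjoint (g '' Φ.cell W x) (Φ.cell W x)
    · exact Or.inr hd
    obtain ⟨_, ⟨u, hu, rfl⟩, hgu⟩ := not_disjoint_iff.1 hd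
    left
    rintro _ ⟨y, hy, rfl⟩
    rw [he y (hsub hy), ← cell_eq hgu, he u (hsub hu)]
    rw [← cell_eq hu] at hy
    exact word_mem_cell hl (hs (hsub hu)) hy

variable [TotallyDisconnectedSpace X]

theorem Equicontinuous.exists_adaptedSet (hΦ : Φ.Equicontinuous) {x : X} {O : Set X}
    (hO : IsOpen O) (hx : x ∈ O) : ∃ U : Φ.AdaptedSet, x ∈ U.carrier ∧ U.carrier ⊆ O := by
  obtain ⟨W, hW, hxW, hWO⟩ := compact_exists_isClopen_in_isOpen hO hx
  obtain ⟨U, hU⟩ := hΦ.exists_adaptedSet_cell hW x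
  exact ⟨U, hU ▸ mem_cell_self W x, hU.subset.trans ((cell_subset hxW).trans hWO)⟩

theorem Equicontinuous.nonempty_adaptedBasis (hΦ : Φ.Equicontinuous) (x : X) :
    Nonempty (Φ.AdaptedBasis x) := by
  -- Each set is chosen inside the previous one and inside a ball of radius `1 / (n + 1)`, which
  -- forces the intersection to be `{x}`.
  choose V hxV hV using fun (n : ℕ) (U : {U : Φ.AdaptedSet // x ∈ U.carrier}) =>
    hΦ.exists_adaptedSet (U.1.isClopen.isOpen.inter (Metric.isOpen_ball (x := x)
      (ε := 1 / ((n : ℝ) + 1)))) ⟨U.2, Metric.mem_ball_self Nat.one_div_pos_of_nat⟩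
  obtain ⟨U₀, hxU₀, -⟩ := hΦ.exists_adaptedSet isOpen_univ (mem_univ x)
  let S : ℕ → {U : Φ.AdaptedSet // x ∈ U.carrier} :=
    Nat.rec ⟨U₀, hxU₀⟩ fun n U => ⟨V n U, hxV n U⟩
  have hS : ∀ n, (S (n + 1)).1.carrier ⊆ (S n).1.carrier ∩ Metric.ball x (1 / ((n : ℝ) + 1)) :=
    fun n => hV n (S n)
  refine ⟨⟨fun n => (S n).1, fun n => (S n).2, fun n => (hS n).trans inter_subset_left, ?_⟩⟩
  refine Subset.antisymm (fun y hy => ?_) ?_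
  · refine eq_of_forall_dist_le fun ε hε => ?_
    obtain ⟨n, hn⟩ := exists_nat_one_div_lt hε
    exact ((hS n (mem_iInter.1 hy (n + 1))).2.trans hn).le
  · rintro _ rfl
    exact mem_iInter.2 fun n => (S n).2

end PseudogroupAction

/-! ### Uniform limits of elements of `𝒢*` -/

namespace PseudogroupAction

section UniformLimits

variable {X : Type u} [MetricSpace X] {Φ : PseudogroupAction X}

/-- On `K`, the map `g` is a uniform limit of elements of `𝒢*` defined on `K`. -/
def UniformLimOn (Φ : PseudogroupAction X) (g : X → X) (K : Set X) : Prop :=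
  ∀ ε > 0, ∃ g' : OpenPartialHomeomorph X X, Φ.Star g' ∧ K ⊆ g'.source ∧
    ∀ x ∈ K, dist (g x) (g' x) < ε

theorem UniformLimOn.mono {g : X → X} {K L : Set X} (h : Φ.UniformLimOn g K) (hL : L ⊆ K) :
    Φ.UniformLimOn g L := fun ε hε => by
  obtain ⟨g', hg', hs, hd⟩ := h ε hε
  exact ⟨g', hg', hL.trans hs, fun x hx => hd x (hL hx)⟩

theorem Star.uniformLimOn {g : OpenPartialHomeomorph X X} (hg : Φ.Star g) {K : Set X}
    (hK : K ⊆ g.source) : Φ.UniformLimOn g K :=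
  fun ε hε => ⟨g, hg, hK, fun x _ => by rwa [dist_self]⟩

theorem AdaptedBasis.antitone {x : X} (𝒰 : Φ.AdaptedBasis x) :
    Antitone fun n => (𝒰.U n).carrier :=
  antitone_nat_of_succ_le 𝒰.descending

variable [CompactSpace X]

/-- Clopenness of `K` makes close approximants of `f` still map `L` into `K`, where `g` is uniformly
continuous and its approximants are defined. -/
theorem UniformLimOn.comp {g f : X → X} {K L : Set X} (hg : Φ.UniformLimOn g K)
    (hf : Φ.UniformLimOn f L) (hK : IsClopen K) (hc : ContinuousOn g K) (hL : MapsTo f L K) :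
    Φ.UniformLimOn (g ∘ f) L := by
  intro ε hε
  obtain ⟨δ, hδ, hgδ⟩ := Metric.uniformContinuousOn_iff.1
    (hK.isClosed.isCompact.uniformContinuousOn_of_continuous hc) (ε / 2) (half_pos hε)
  obtain ⟨r, hr, hrK⟩ := hK.exists_radius
  obtain ⟨g', hg', hgs, hgd⟩ := hg (ε / 2) (half_pos hε)
  obtain ⟨f', hf', hfs, hfd⟩ := hf (min δ r) (lt_min hδ hr)
  have hfK : ∀ x ∈ L, f' x ∈ K := fun x hx => hrK _ (hL hx) (by
    rw [Metric.mem_ball, dist_comm]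
    exact lt_of_lt_of_le (hfd x hx) (min_le_right _ _))
  refine ⟨f'.trans g', hf'.trans hg', fun x hx => ⟨hfs hx, hgs (hfK x hx)⟩, fun x hx => ?_⟩
  calc dist (g (f x)) (g' (f' x)) ≤ dist (g (f x)) (g (f' x)) + dist (g (f' x)) (g' (f' x)) :=
        dist_triangle _ _ _
    _ < ε / 2 + ε / 2 := add_lt_add
        (hgδ _ (hL hx) _ (hfK x hx) (lt_of_lt_of_le (hfd x hx) (min_le_left _ _)))
        (hgd _ (hfK x hx))
    _ = ε := add_halves ε

namespace AdaptedSet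

theorem uniformLimOn (U : Φ.AdaptedSet) {x : X} (hx : x ∈ U.carrier) {f : U.carrier ≃ₜ U.carrier}
    (hf : f ∈ uniformClosure U.H) {g : X → X} (hg : ∀ u : U.carrier, g u = f u) :
    Φ.UniformLimOn g U.carrier := by
  intro ε hε
  obtain ⟨h, hh, hd⟩ := hf ε hε
  obtain ⟨g', hg', hs, hgh⟩ := exists_star U U subset_rfl x hx h hh
  refine ⟨g', hg'.1, hs.superset, fun y hy => ?_⟩
  rw [hg ⟨y, hy⟩, hgh ⟨y, hy⟩ hy]
  exact hd ⟨y, hy⟩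

/-- An approximant closer than the radius `r` of `U` also maps `U` into `U`. Restricted to `U`, it
lies in `𝒢*_U` and hence comes from `U.H`. -/
theorem mem_uniformClosure (U : Φ.AdaptedSet) {f : U.carrier ≃ₜ U.carrier} {g : X → X}
    (hg : ∀ u : U.carrier, g u = f u) (h : Φ.UniformLimOn g U.carrier) :
    f ∈ uniformClosure U.H := by
  intro ε hε
  obtain ⟨r, hr, hrU⟩ := U.isClopen.exists_radius
  obtain ⟨g', hg', hs, hd⟩ := h (min ε r) (lt_min hε hr)
  have hsrc : (g'.restr U.carrier).source = U.carrier := by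
    rw [g'.restr_source' _ U.isClopen.isOpen, inter_eq_right]
    exact hs
  have hU : Φ.StarOn U.carrier (g'.restr U.carrier) := by
    refine ⟨hg'.restr U.isClopen.isOpen, hsrc.subset, ?_⟩
    rw [← (g'.restr U.carrier).image_source_eq_target, hsrc]
    rintro _ ⟨y, hy, rfl⟩
    refine hrU (g y) (hg ⟨y, hy⟩ ▸ (f ⟨y, hy⟩).2) ?_
    rw [Metric.mem_ball, dist_comm]
    exact lt_of_lt_of_le (hd y hy) (min_le_right _ _)
  obtain ⟨-, k, hk, hgk⟩ := (U.induced _).1 hU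
  refine ⟨k, hk, fun u => ?_⟩
  have h1 := lt_of_lt_of_le (hd u u.2) (min_le_left _ _)
  have h2 : g' u = k u := hgk u (hsrc.superset u.2)
  rw [hg, h2] at h1
  exact h1

/-- A close approximant sends the fixed point `y` into `V`, so the contained-or-disjoint alternative
makes it preserve `V`; being within `r` of it, `g` does too. -/
theorem mapsTo_of_uniformLimOn (V : Φ.AdaptedSet) {g : X → X} (h : Φ.UniformLimOn g V.carrier)
    {y : X} (hy : y ∈ V.carrier) (hgy : g y = y) : MapsTo g V.carrier V.carrier := by
  obtain ⟨r, hr, hrV⟩ := V.isClopen.exists_radius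
  obtain ⟨g', hg', hs, hd⟩ := h r hr
  have hsub : g' '' V.carrier ⊆ V.carrier := by
    refine (V.translate g' hg' hs).resolve_right fun hdis => ?_
    refine disjoint_left.1 hdis ⟨y, hy, rfl⟩ (hrV y hy ?_)
    have := hd y hy
    rwa [hgy, dist_comm] at this
  exact fun v hv => hrV _ (hsub ⟨v, hv, rfl⟩) (hd v hv)

end AdaptedSet

end UniformLimits

/-- The extension by the identity of a self-map of a set. -/
noncomputable def extendId {X : Type u} {U : Set X} (f : U → U) : X → X :=
  Function.extend Subtype.val (fun u => (f u : X)) id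

theorem extendId_apply {X : Type u} {U : Set X} (f : U → U) (u : U) : extendId f u = f u :=
  Subtype.val_injective.extend_apply _ _ u

theorem extendId_mapsTo {X : Type u} {U : Set X} (f : U → U) : MapsTo (extendId f) U U :=
  fun x hx => by
    rw [show extendId f x = f ⟨x, hx⟩ from extendId_apply f ⟨x, hx⟩]
    exact (f ⟨x, hx⟩).2

theorem continuousOn_extendId {X : Type u} [TopologicalSpace X] {U : Set X} {f : U → U}
    (hf : Continuous f) : ContinuousOn (extendId f) U := by
  rw [continuousOn_iff_continuous_domRestrict]
  convert continuous_subtype_val.comp hf using 1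
  exact funext (extendId_apply f)

variable {X : Type u} [MetricSpace X] [CompactSpace X] {Φ : PseudogroupAction X}

theorem AdaptedBasis.exists_subset {x : X} (𝒰 : Φ.AdaptedBasis x) {O : Set X} (hO : IsOpen O)
    (hx : x ∈ O) (m : ℕ) : ∃ n ≥ m, (𝒰.U n).carrier ⊆ O := by
  obtain ⟨n, hn⟩ := exists_subset_nhds_of_compactSpace (V := fun n => (𝒰.U n).carrier)
    𝒰.antitone.directed_ge (fun n => (𝒰.U n).isClopen.isClosed) (U := O) fun y hy => by
      rw [𝒰.iInter_eq] at hy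
      rw [mem_singleton_iff.1 hy]
      exact hO.mem_nhds hx
  exact ⟨max m n, le_max_left _ _, (𝒰.antitone (le_max_right m n)).trans hn⟩

theorem AdaptedBasis.isotropySeq_comp_apply {x : X} (𝒰 : Φ.AdaptedBasis x)
    (hΦ : Φ.Equicontinuous) {m n : ℕ} (h : m ≤ n) (f : (𝒰.U m).isotropy x (𝒰.mem m))
    (v : (𝒰.U n).carrier) :
    ((show (𝒰.U n).isotropy x (𝒰.mem n) from (𝒰.isotropySeq hΦ).comp h f).1 v : X) =
      f.1 ⟨v, 𝒰.antitone h v.2⟩ := by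
  induction n, h using Nat.le_induction with
  | base =>
    exact congrArg (fun k : (𝒰.U m).isotropy x (𝒰.mem m) => (k.1 v : X))
      (SurjSeq.comp_refl (𝒰.isotropySeq hΦ) m f)
  | succ n hmn ih =>
    exact (congrArg (fun k : (𝒰.U (n + 1)).isotropy x (𝒰.mem (n + 1)) => (k.1 v : X))
      (SurjSeq.comp_succ (𝒰.isotropySeq hΦ) hmn _ f)).trans (ih ⟨v, 𝒰.descending n v.2⟩)

theorem AdaptedBasis.isotropySeq_comp_eq_one_iff {x : X} (𝒰 : Φ.AdaptedBasis x)
    (hΦ : Φ.Equicontinuous) {m n : ℕ} (h : m ≤ n) (f : (𝒰.U m).isotropy x (𝒰.mem m)) :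
    (𝒰.isotropySeq hΦ).comp h f = 1 ↔
      ∀ v : (𝒰.U n).carrier, (f.1 ⟨v, 𝒰.antitone h v.2⟩ : X) = v := by
  constructor
  · intro h1 v
    rw [← 𝒰.isotropySeq_comp_apply hΦ h, h1]
    rfl
  · intro h1
    refine Subtype.ext (Homeomorph.ext fun v => Subtype.ext ?_)
    exact (𝒰.isotropySeq_comp_apply hΦ h f v).trans (h1 v)

/-! ### Conjugation of isotropy groups by local homeomorphisms -/

section Transfer

variable {X₁ X₂ : Type u} [MetricSpace X₁] [CompactSpace X₁] [MetricSpace X₂]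
  {Φ₁ : PseudogroupAction X₁} {Φ₂ : PseudogroupAction X₂}

/-- Conjugation by `φ` carries uniform limits of elements of `𝒢₁*` to uniform limits of elements of
`𝒢₂*`. -/
def Transfers (Φ₁ : PseudogroupAction X₁) (Φ₂ : PseudogroupAction X₂)
    (φ : OpenPartialHomeomorph X₁ X₂) : Prop :=
  ∀ (K : Set X₁) (g : X₁ → X₁), IsClopen K → K ⊆ φ.source → MapsTo g K K → ContinuousOn g K →
    Φ₁.UniformLimOn g K → ∀ L : Set X₂, L ⊆ φ.target → MapsTo φ.symm L K →
      Φ₂.UniformLimOn (φ ∘ g ∘ φ.symm) L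

/-- Conjugation by a local homeomorphism that preserves the restricted pseudo⋆groups. -/
theorem transfers_of_starOn {φ : OpenPartialHomeomorph X₁ X₂}
    (hφ : ∀ g, Φ₁.StarOn φ.source g → Φ₂.StarOn φ.target ((φ.symm.trans g).trans φ)) :
    Transfers Φ₁ Φ₂ φ := by
  intro K g hK hKs hgK _ hg L hL hLK ε hε
  obtain ⟨δ, hδ, hφδ⟩ := Metric.uniformContinuousOn_iff.1
    (hK.isClosed.isCompact.uniformContinuousOn_of_continuous (φ.continuousOn.mono hKs)) ε hε
  obtain ⟨r, hr, hrK⟩ := hK.exists_radius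
  obtain ⟨g', hg', hs, hd⟩ := hg (min δ r) (lt_min hδ hr)
  have hgK' : ∀ y ∈ K, g' y ∈ K := fun y hy => hrK _ (hgK hy) (by
    rw [Metric.mem_ball, dist_comm]
    exact lt_of_lt_of_le (hd y hy) (min_le_right _ _))
  -- The hypothesis concerns only maps with domain and range in `φ.source`, so the approximant is
  -- cut down to `K`, which it preserves.
  have hsrc : (g'.restr K).source = K := by
    rw [g'.restr_source' _ hK.isOpen, inter_eq_right]
    exact hs
  have hstar : Φ₁.StarOn φ.source (g'.restr K) := by
    refine ⟨hg'.restr hK.isOpen, hsrc.subset.trans hKs, ?_⟩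
    rw [← (g'.restr K).image_source_eq_target, hsrc]
    rintro _ ⟨y, hy, rfl⟩
    exact hKs (hgK' y hy)
  refine ⟨_, (hφ _ hstar).1, fun v hv => ⟨⟨hL hv, hsrc.superset (hLK hv)⟩,
    hKs (hgK' _ (hLK hv))⟩, fun v hv => ?_⟩
  exact hφδ _ (hgK (hLK hv)) _ (hgK' _ (hLK hv))
    (lt_of_lt_of_le (hd _ (hLK hv)) (min_le_left _ _))

variable [CompactSpace X₂]

/-- Conjugation by `φ` carries isotropy elements to isotropy elements. -/
theorem Transfers.exists_isotropy {φ : OpenPartialHomeomorph X₁ X₂} (hφ : Transfers Φ₁ Φ₂ φ)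
    (U : Φ₁.AdaptedSet) (V : Φ₂.AdaptedSet) (hU : U.carrier ⊆ φ.source)
    (hV : V.carrier ⊆ φ.target) (hVU : MapsTo φ.symm V.carrier U.carrier) {x : X₁} {y : X₂}
    (hx : x ∈ U.carrier) (hy : y ∈ V.carrier) (hxy : φ.symm y = x) (f : U.isotropy x hx) :
    ∃ k : V.isotropy y hy, ∀ v : V.carrier, (k.1 v : X₂) = φ (f.1 ⟨φ.symm v, hVU v.2⟩) := by
  have hφx : φ x = y := by rw [← hxy, φ.right_inv (hV hy)]
  have hval : ∀ (a : U.isotropy x hx) (v : V.carrier),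
      (φ ∘ extendId a.1 ∘ φ.symm) v = φ (a.1 ⟨φ.symm v, hVU v.2⟩) := fun a v =>
    congrArg φ (extendId_apply a.1 ⟨φ.symm v, hVU v.2⟩)
  have hlim : ∀ a : U.isotropy x hx,
      Φ₂.UniformLimOn (φ ∘ extendId a.1 ∘ φ.symm) V.carrier := fun a =>
    hφ _ _ U.isClopen hU (extendId_mapsTo _) (continuousOn_extendId a.1.continuous)
      (U.uniformLimOn hx a.2.1 (extendId_apply _)) _ hV hVU
  have hfix : ∀ a : U.isotropy x hx, (φ ∘ extendId a.1 ∘ φ.symm) y = y := by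
    intro a
    rw [hval a ⟨y, hy⟩]
    have : (⟨φ.symm y, hVU hy⟩ : U.carrier) = ⟨x, hx⟩ := Subtype.ext hxy
    rw [this, a.2.2, hφx]
  -- A priori the conjugate maps `V` only into the image of `U`; fixing `y` is what keeps `V`
  -- invariant.
  have hmaps : ∀ a : U.isotropy x hx,
      MapsTo (φ ∘ extendId a.1 ∘ φ.symm) V.carrier V.carrier := fun a =>
    V.mapsTo_of_uniformLimOn (hlim a) hy (hfix a)
  have hcont : ∀ a : U.isotropy x hx,
      ContinuousOn (φ ∘ extendId a.1 ∘ φ.symm) V.carrier := fun a =>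
    (φ.continuousOn.mono hU).comp
      ((continuousOn_extendId a.1.continuous).comp (φ.continuousOn_symm.mono hV) hVU)
      ((extendId_mapsTo _).comp hVU)
  have hinv : ∀ (a b : U.isotropy x hx), (∀ u, a.1 (b.1 u) = u) → ∀ v ∈ V.carrier,
      (φ ∘ extendId a.1 ∘ φ.symm) ((φ ∘ extendId b.1 ∘ φ.symm) v) = v := by
    intro a b hab v hv
    rw [hval b ⟨v, hv⟩]
    have h1 := hU (b.1 ⟨φ.symm v, hVU hv⟩).2
    simp only [Function.comp_apply]
    rw [φ.left_inv h1, extendId_apply, hab]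
    exact φ.right_inv (hV hv)
  let k : V.carrier ≃ₜ V.carrier :=
    { toFun := (hmaps f).restrict _ _ _
      invFun := (hmaps f⁻¹).restrict _ _ _
      left_inv := fun v => Subtype.ext (hinv f⁻¹ f (fun u => f.1.symm_apply_apply u) v v.2)
      right_inv := fun v => Subtype.ext (hinv f f⁻¹ (fun u => f.1.apply_symm_apply u) v v.2)
      continuous_toFun := (hcont f).mapsToRestrict _
      continuous_invFun := (hcont f⁻¹).mapsToRestrict _ }
  exact ⟨⟨k, V.mem_uniformClosure (f := k) (fun _ => rfl) (hlim f), Subtype.ext (hfix f)⟩, hval f⟩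

/-- The surjection required by `Intertwined` is conjugation by `φ`, restricted to a small set of the
second basis. -/
theorem Transfers.tailEquiv {φ : OpenPartialHomeomorph X₁ X₂} (hφ : Transfers Φ₁ Φ₂ φ)
    (hφ' : Transfers Φ₂ Φ₁ φ.symm) (h₁ : Φ₁.Equicontinuous) (h₂ : Φ₂.Equicontinuous)
    {x : X₁} {y : X₂} (hx : x ∈ φ.source) (hxy : φ x = y) (𝒰 : Φ₁.AdaptedBasis x)
    (𝒱 : Φ₂.AdaptedBasis y) : SurjSeq.TailEquiv (𝒰.isotropySeq h₁) (𝒱.isotropySeq h₂) := by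
  have hy : y ∈ φ.target := hxy ▸ φ.map_source hx
  have hyx : φ.symm y = x := by rw [← hxy, φ.left_inv hx]
  have hUV : ∀ m n, ∃ m' ≥ m, (𝒰.U m').carrier ⊆ φ.source ∩ φ ⁻¹' (𝒱.U n).carrier := fun m n =>
    𝒰.exists_subset (φ.isOpen_inter_preimage (𝒱.U n).isClopen.isOpen)
      ⟨hx, by rw [mem_preimage, hxy]; exact 𝒱.mem n⟩ m
  have hVU : ∀ n m, ∃ n' ≥ n, (𝒱.U n').carrier ⊆ φ.target ∩ φ.symm ⁻¹' (𝒰.U m).carrier :=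
    fun n m => 𝒱.exists_subset (φ.symm.isOpen_inter_preimage (𝒰.U m).isClopen.isOpen)
      ⟨hy, by rw [mem_preimage, hyx]; exact 𝒰.mem m⟩ n
  -- The sets are nested so that `φ` maps `𝒰.U m` into `𝒱.U l` and its image contains `𝒱.U n`. The
  -- middle set carries the source of `S`, and the outer one serves for surjectivity.
  obtain ⟨l, -, hl⟩ := 𝒱.exists_subset φ.open_target hy 0
  obtain ⟨m, -, hm⟩ := hUV 0 l
  obtain ⟨n, hln, hn⟩ := hVU l m
  have hmaps : MapsTo φ.symm (𝒱.U n).carrier (𝒰.U m).carrier := fun v hv => (hn hv).2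
  choose s hs using hφ.exists_isotropy (𝒰.U m) (𝒱.U n) (fun u hu => (hm hu).1)
    (fun v hv => (hn hv).1) hmaps (𝒰.mem m) (𝒱.mem n) hyx
  let S : (𝒰.U m).isotropy x (𝒰.mem m) →* (𝒱.U n).isotropy y (𝒱.mem n) :=
    MonoidHom.mk' s fun a b => Subtype.ext <| Homeomorph.ext fun v => Subtype.ext <| by
      rw [hs]
      change φ (a.1 (b.1 _)) = (s a).1 ((s b).1 v)
      rw [hs]
      congr 3
      refine Subtype.ext ?_
      exact (φ.left_inv (hm (b.1 _).2).1).symm.trans (congrArg φ.symm (hs b v).symm)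
  refine SurjSeq.Intertwined.tailEquiv ⟨m, n, S, ?_, fun n' h => ?_, fun m' h => ?_⟩
  · intro k
    -- Since `φ` may map `𝒰.U m` outside `𝒱.U n`, the element `k` is first extended to `𝒱.U l` and
    -- only then conjugated back.
    obtain ⟨k', hk'⟩ := AdaptedSet.restrictIsotropy_surjective h₂ (𝒱.U l) (𝒱.U n)
      (𝒱.antitone hln) y (𝒱.mem n) k
    obtain ⟨f, hf⟩ := hφ'.exists_isotropy (𝒱.U l) (𝒰.U m) hl (fun u hu => (hm hu).1)
      (fun u hu => (hm hu).2) (𝒱.mem l) (𝒰.mem m) hxy k'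
    refine ⟨f, Subtype.ext (Homeomorph.ext fun v => Subtype.ext ?_)⟩
    rw [← hk']
    refine (hs f v).trans ((congrArg φ (hf _)).trans ((φ.right_inv (hl (k'.1 _).2)).trans ?_))
    exact congrArg (fun z => (k'.1 z : X₂)) (Subtype.ext (φ.right_inv (hn v.2).1))
  · obtain ⟨m', hm', hsub⟩ := hUV m n'
    -- Here `φ` maps `𝒰.U m'` into `𝒱.U n'`, so if the conjugate is trivial on the latter,
    -- injectivity of `φ` makes `f` trivial on the former.
    refine ⟨m', hm', fun (f : (𝒰.U m).isotropy x (𝒰.mem m)) hf =>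
      (𝒰.isotropySeq_comp_eq_one_iff h₁ hm' f).2 fun u => ?_⟩
    have hu := hsub u.2
    have h1 := (𝒱.isotropySeq_comp_eq_one_iff h₂ h (S f)).1 hf ⟨φ u, hu.2⟩
    have h2 := (hs f ⟨φ u, 𝒱.antitone h hu.2⟩).symm.trans h1
    have h3 := φ.injOn (hm (f.1 _).2).1 hu.1 h2
    exact (congrArg (fun z => (f.1 z : X₁)) (Subtype.ext (φ.left_inv hu.1).symm)).trans h3
  · obtain ⟨n', hn', hsub⟩ := hVU n m'
    refine ⟨n', hn', fun (f : (𝒰.U m).isotropy x (𝒰.mem m)) hf =>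
      (𝒱.isotropySeq_comp_eq_one_iff h₂ hn' (S f)).2 fun v => ?_⟩
    have hv := hsub v.2
    have h1 := (𝒰.isotropySeq_comp_eq_one_iff h₁ h f).1 hf ⟨φ.symm v, hv.2⟩
    refine (hs f ⟨v, 𝒱.antitone hn' v.2⟩).trans ?_
    exact (congrArg φ h1).trans (φ.right_inv hv.1)

/-- Conjugation by a local homeomorphism that is locally a uniform limit of elements of `𝒢*`. -/
theorem transfers_of_uniformLimOn {φ : OpenPartialHomeomorph X X}
    (hφ : ∀ K ⊆ φ.source, Φ.UniformLimOn φ K)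
    (hφ' : ∀ L ⊆ φ.target, Φ.UniformLimOn φ.symm L) : Transfers Φ Φ φ := by
  intro K g hK hKs hgK hgc hg L hL hLK
  exact (hφ K hKs).comp (hg.comp (hφ' L hL) hK hgc hLK) hK (φ.continuousOn.mono hKs)
    (hgK.comp hLK)

theorem tailEquiv_of_uniformLimOn (hΦ : Φ.Equicontinuous) {φ : OpenPartialHomeomorph X X}
    (hφ : ∀ K ⊆ φ.source, Φ.UniformLimOn φ K)
    (hφ' : ∀ L ⊆ φ.target, Φ.UniformLimOn φ.symm L)
    {x y : X} (hx : x ∈ φ.source) (hxy : φ x = y) (𝒰 : Φ.AdaptedBasis x)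
    (𝒱 : Φ.AdaptedBasis y) : SurjSeq.TailEquiv (𝒰.isotropySeq hΦ) (𝒱.isotropySeq hΦ) :=
  (transfers_of_uniformLimOn hφ hφ').tailEquiv (transfers_of_uniformLimOn hφ' hφ) hΦ hΦ hx hxy
    𝒰 𝒱

end Transfer

/-! ### Independence of choices, minimal actions and return equivalence -/

theorem tailEquiv_of_star (hΦ : Φ.Equicontinuous) {g : OpenPartialHomeomorph X X}
    (hg : Φ.Star g) {x y : X} (hx : x ∈ g.source) (hxy : g x = y) (𝒰 : Φ.AdaptedBasis x)
    (𝒱 : Φ.AdaptedBasis y) : SurjSeq.TailEquiv (𝒰.isotropySeq hΦ) (𝒱.isotropySeq hΦ) :=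
  tailEquiv_of_uniformLimOn hΦ (fun _ h => hg.uniformLimOn h) (fun _ h => hg.symm.uniformLimOn h)
    hx hxy 𝒰 𝒱

theorem tailEquiv_of_same_point (hΦ : Φ.Equicontinuous) {x : X} (𝒰 𝒱 : Φ.AdaptedBasis x) :
    SurjSeq.TailEquiv (𝒰.isotropySeq hΦ) (𝒱.isotropySeq hΦ) := by
  have hxi : x ∈ ⋃ i, Φ.T i := Φ.iUnion_T ▸ mem_univ x
  obtain ⟨i, hi⟩ := mem_iUnion.1 hxi
  exact tailEquiv_of_star hΦ (star_refl i) ((Φ.source_refl i).superset hi) (Φ.h_refl i x hi) 𝒰 𝒱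

theorem AdaptedSet.equicontinuous (hΦ : Φ.Equicontinuous) (U : Φ.AdaptedSet) {x : X}
    (hx : x ∈ U.carrier) :
    ∀ ε > 0, ∃ δ > 0, ∀ h ∈ U.H, ∀ y z, dist y z < δ → dist (h y) (h z) < ε := by
  intro ε hε
  obtain ⟨δ, hδ, H⟩ := hΦ ε hε
  refine ⟨δ, hδ, fun h hh y z hyz => ?_⟩
  obtain ⟨g, hg, hgs, hgh⟩ := exists_star U U subset_rfl x hx h hh
  have := H g hg.1 y (hgs.superset y.2) z (hgs.superset z.2) hyz
  rwa [hgh y y.2, hgh z z.2] at this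

/-- For a minimal action, the closure of `ℋ_U` is transitive on `U`. -/
theorem AdaptedSet.exists_apply_eq (hΦ : Φ.Equicontinuous) (hmin : Φ.Minimal) (U : Φ.AdaptedSet)
    (x y : U.carrier) : ∃ f ∈ uniformClosure U.H, f x = y := by
  have happrox : ∀ n : ℕ, ∃ h ∈ U.H, dist (h x) y < 1 / ((n : ℝ) + 1) := by
    intro n
    obtain ⟨z, ⟨g, hg, hxg, rfl⟩, hzU, hzy⟩ := (hmin x).exists_mem_open
      (U.isClopen.isOpen.inter (Metric.isOpen_ball (x := (y : X)) (ε := 1 / ((n : ℝ) + 1))))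
      ⟨y, y.2, Metric.mem_ball_self Nat.one_div_pos_of_nat⟩
    have hO : IsOpen (g.source ∩ g ⁻¹' U.carrier) := g.isOpen_inter_preimage U.isClopen.isOpen
    -- The domain is cut down to points of `U` with image in `U`, so that the map belongs to `𝒢*_U`
    -- and agrees with an element of `U.H`.
    let k := g.restr ((g.source ∩ g ⁻¹' U.carrier) ∩ U.carrier)
    have hks : k.source = g.source ∩ ((g.source ∩ g ⁻¹' U.carrier) ∩ U.carrier) :=
      g.restr_source' _ (hO.inter U.isClopen.isOpen)
    have hk : Φ.StarOn U.carrier k := by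
      refine ⟨hg.restr (hO.inter U.isClopen.isOpen), fun u hu => (hks.subset hu).2.2, ?_⟩
      rw [← k.image_source_eq_target]
      rintro _ ⟨u, hu, rfl⟩
      exact (hks.subset hu).2.1.2
    obtain ⟨-, h, hh, hkh⟩ := (U.induced k).1 hk
    refine ⟨h, hh, ?_⟩
    have h1 : g x = h x := hkh x (hks.superset ⟨hxg, ⟨hxg, hzU⟩, x.2⟩)
    rw [Subtype.dist_eq, ← h1]
    exact hzy
  choose h hh hd using happrox
  obtain ⟨f, hf, hlim⟩ := exists_uniform_limit U.H (U.equicontinuous hΦ x.2) h hh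
  refine ⟨f, hf, eq_of_forall_dist_le fun ε hε => ?_⟩
  have h1 : ∀ᶠ n : ℕ in atTop, 1 / ((n : ℝ) + 1) < ε / 2 :=
    (tendsto_order.1 tendsto_one_div_add_atTop_nhds_zero_nat).2 _ (half_pos hε)
  obtain ⟨n, hn1, hn2⟩ := ((hlim x (ε / 2) (half_pos hε)).and_eventually h1).exists
  have h2 := dist_triangle (f x) (h n x) y
  linarith [hd n]

/-- By transitivity some `f` in the closure of `U.H` takes `x` to `y`. Both `f` and its inverse are
uniform limits of elements of `𝒢*`, so conjugation by `f` transfers isotropy. -/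
theorem tailEquiv_of_mem_adaptedSet (hΦ : Φ.Equicontinuous) (hmin : Φ.Minimal)
    (U : Φ.AdaptedSet) {x y : X} (hx : x ∈ U.carrier) (hy : y ∈ U.carrier)
    (𝒰 : Φ.AdaptedBasis x) (𝒱 : Φ.AdaptedBasis y) :
    SurjSeq.TailEquiv (𝒰.isotropySeq hΦ) (𝒱.isotropySeq hΦ) := by
  obtain ⟨f, hf, hfx⟩ := U.exists_apply_eq hΦ hmin ⟨x, hx⟩ ⟨y, hy⟩
  obtain ⟨g, hgs, hg⟩ := AdaptedSet.exists_local U U subset_rfl x hx f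
  have hg' : ∀ u : U.carrier, g u = f u := fun u => hg u u.2
  have hgt : g.target = U.carrier := by
    rw [← g.image_source_eq_target, hgs]
    refine Subset.antisymm ?_ fun v hv => ⟨f.symm ⟨v, hv⟩, Subtype.coe_prop _, ?_⟩
    · rintro _ ⟨u, hu, rfl⟩
      rw [hg' ⟨u, hu⟩]
      exact (f ⟨u, hu⟩).2
    · rw [hg', f.apply_symm_apply]
  have hg'' : ∀ u : U.carrier, g.symm u = f.symm u := fun u => by
    have h1 : (f.symm u : X) ∈ g.source := hgs.superset (f.symm u).2
    have h2 := g.left_inv h1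
    rwa [hg', f.apply_symm_apply] at h2
  refine tailEquiv_of_uniformLimOn hΦ (φ := g) (fun K hK => ?_) (fun L hL => ?_)
    (hgs.superset hx) ?_ 𝒰 𝒱
  · exact (U.uniformLimOn hx hf hg').mono (hK.trans hgs.subset)
  · exact (U.uniformLimOn hx ((uniformClosure U.H).inv_mem hf) hg'').mono (hL.trans hgt.subset)
  · rw [hg' ⟨x, hx⟩, hfx]

/-- Density of the orbit of `x` gives a point `z` of it in `𝒱.U 0`. An element of `𝒢*` leads from
`x` to `z`, and the closure of the group of `𝒱.U 0` leads from `z` to `y`. -/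
theorem Minimal.tailEquiv [TotallyDisconnectedSpace X] (hmin : Φ.Minimal)
    (hΦ : Φ.Equicontinuous) {x y : X} (𝒰 : Φ.AdaptedBasis x) (𝒱 : Φ.AdaptedBasis y) :
    SurjSeq.TailEquiv (𝒰.isotropySeq hΦ) (𝒱.isotropySeq hΦ) := by
  obtain ⟨z, ⟨g, hg, hxg, hgz⟩, hz⟩ :=
    (hmin x).exists_mem_open (𝒱.U 0).isClopen.isOpen ⟨y, 𝒱.mem 0⟩
  obtain ⟨𝒲⟩ := hΦ.nonempty_adaptedBasis z
  exact (tailEquiv_of_star hΦ hg hxg hgz 𝒰 𝒲).trans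
    (tailEquiv_of_mem_adaptedSet hΦ hmin (𝒱.U 0) hz (𝒱.mem 0) 𝒲 𝒱)

theorem Minimal.asymptoticDiscriminant_eq [TotallyDisconnectedSpace X] (hmin : Φ.Minimal)
    (hΦ : Φ.Equicontinuous) {x : X} (𝒰 : Φ.AdaptedBasis x) :
    Φ.asymptoticDiscriminant hΦ = (𝒰.isotropySeq hΦ).asymptoticClass := by
  refine Subset.antisymm (iUnion₂_subset fun y 𝒱 => ?_)
    (subset_iUnion₂_of_subset x 𝒰 subset_rfl)
  exact (hmin.tailEquiv hΦ 𝒱 𝒰).asymptoticClass_eq.subset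

theorem ReturnEquivalent.asymptoticDiscriminant_eq {X₁ X₂ : Type u}
    [MetricSpace X₁] [CompactSpace X₁] [TotallyDisconnectedSpace X₁]
    [MetricSpace X₂] [CompactSpace X₂] [TotallyDisconnectedSpace X₂]
    {Φ₁ : PseudogroupAction X₁} {Φ₂ : PseudogroupAction X₂} (h : ReturnEquivalent Φ₁ Φ₂)
    (h₁ : Φ₁.Equicontinuous) (h₂ : Φ₂.Equicontinuous) (hm₁ : Φ₁.Minimal) (hm₂ : Φ₂.Minimal) :
    Φ₁.asymptoticDiscriminant h₁ = Φ₂.asymptoticDiscriminant h₂ := by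
  obtain ⟨φ, ⟨x, hx⟩, hφ, hφ'⟩ := h
  obtain ⟨𝒰⟩ := h₁.nonempty_adaptedBasis x
  obtain ⟨𝒱⟩ := h₂.nonempty_adaptedBasis (φ x)
  rw [hm₁.asymptoticDiscriminant_eq h₁ 𝒰, hm₂.asymptoticDiscriminant_eq h₂ 𝒱]
  exact ((transfers_of_starOn hφ).tailEquiv (transfers_of_starOn (φ := φ.symm) hφ') h₁ h₂ hx rfl
    𝒰 𝒱).asymptoticClass_eq

end PseudogroupAction

theorem proposition4p10 {X₁ X₂ : Type u}
    [MetricSpace X₁] [CompactSpace X₁] [TotallyDisconnectedSpace X₁] [PerfectSpace X₁] [Nonempty X₁]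
    [MetricSpace X₂] [CompactSpace X₂] [TotallyDisconnectedSpace X₂] [PerfectSpace X₂] [Nonempty X₂]
    (Φ₁ : PseudogroupAction X₁) (Φ₂ : PseudogroupAction X₂)
    (h₁ : Φ₁.Equicontinuous) (h₂ : Φ₂.Equicontinuous) :
    -- adapted neighborhood bases exist at every point
    (∀ x : X₁, Nonempty (Φ₁.AdaptedBasis x)) ∧
    -- two adapted neighborhood bases at the same point (no minimality)
    (∀ (x : X₁) (𝒰 𝒱 : Φ₁.AdaptedBasis x),
      SurjSeq.TailEquiv (𝒰.isotropySeq h₁) (𝒱.isotropySeq h₁)) ∧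
    -- adapted neighborhood bases at two points of one orbit (no minimality)
    (∀ (x y : X₁) (𝒰 : Φ₁.AdaptedBasis x) (𝒱 : Φ₁.AdaptedBasis y),
      (∃ g, Φ₁.Star g ∧ x ∈ g.source ∧ g x = y) →
        SurjSeq.TailEquiv (𝒰.isotropySeq h₁) (𝒱.isotropySeq h₁)) ∧
    -- minimal actions: adapted neighborhood bases at arbitrary points
    (Φ₁.Minimal → ∀ (x y : X₁) (𝒰 : Φ₁.AdaptedBasis x) (𝒱 : Φ₁.AdaptedBasis y),
      SurjSeq.TailEquiv (𝒰.isotropySeq h₁) (𝒱.isotropySeq h₁)) ∧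
    -- minimal actions: the asymptotic discriminant is the class given by any choice
    (Φ₁.Minimal → ∀ (x : X₁) (𝒰 : Φ₁.AdaptedBasis x),
      Φ₁.asymptoticDiscriminant h₁ = (𝒰.isotropySeq h₁).asymptoticClass) ∧
    -- minimal actions: the asymptotic discriminant is an invariant of return equivalence
    (Φ₁.Minimal → Φ₂.Minimal → PseudogroupAction.ReturnEquivalent Φ₁ Φ₂ →
      Φ₁.asymptoticDiscriminant h₁ = Φ₂.asymptoticDiscriminant h₂) := by
  refine ⟨h₁.nonempty_adaptedBasis, fun x 𝒰 𝒱 => PseudogroupAction.tailEquiv_of_same_point h₁ 𝒰 𝒱,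
    fun x y 𝒰 𝒱 => ?_, fun hm x y 𝒰 𝒱 => hm.tailEquiv h₁ 𝒰 𝒱,
    fun hm x 𝒰 => hm.asymptoticDiscriminant_eq h₁ 𝒰,
    fun hm₁ hm₂ h => h.asymptoticDiscriminant_eq h₁ h₂ hm₁ hm₂⟩
  rintro ⟨g, hg, hx, hxy⟩
  exact PseudogroupAction.tailEquiv_of_star h₁ hg hx hxy 𝒰 𝒱
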